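/- There are universal constants $C_1,C_2,C_3>0$ such that the following holds. Setting. Let $n\ge 2$, and let $\theta^\star\in\mathbb{R}^n$ satisfy $\theta^\star_1\ge\cdots\ge\theta^\star_n$ and $\sum_i\theta^\star_i=0$. Put $\kappa=e^{\theta^\star_1}/e^{\theta^\star_n}$. Let $\mathcal{G}=([n],\mathcal{E})$ be a (fixed) comparison graph. For every edge $(i,j)\in\mathcal{E}$ with $i>j$ we observe $L$ outcomes $y_{ij}^{(1)},\dots,y_{ij}^{(L)}\in\{0,1\}$. All outcomes are independent, with $\mathbb{P}(y_{ij}^{(l)}=1)=e^{\theta^\star_j}/(e^{\theta^\star_i}+e^{\theta^\star_j})$; write $y_{ji}^{(l)}=1-y_{ij}^{(l)}$. Let $w=\{w_{ij}\}$ be symmetric nonnegative weights supported on $\mathcal{E}$, possibly random but independent of the family of observed outcomes. Let $$w_{\max}=\max_{i,j}w_{ij},\quad d_{\max}=\max_i\sum_{j\ne i}w_{ij},\quad d_{\min}=\min_i\sum_{j\ne i}w_{ij},\quad \boldsymbol{L}_w=\sum_{i>j}w_{ij}(e_i-e_j)(e_i-e_j)^\top,$$ and let $\lambda_{n-1}(\boldsymbol{L}_w)$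 be the second smallest eigenvalue of $\boldsymbol{L}_w$, counted with multiplicity. The weighted MLE $\widehat\theta$ is the minimizer, over all $\theta\in\mathbb{R}^n$ with $\sum_i\theta_i=0$, of $$\mathcal{L}_w(\theta)=-\frac1L\sum_{i>j}\sum_{l=1}^{L}w_{ij}\log\Bigl(y_{ji}^{(l)}\frac{e^{\theta_i}}{e^{\theta_i}+e^{\theta_j}}+(1-y_{ji}^{(l)})\frac{e^{\theta_j}}{e^{\theta_i}+e^{\theta_j}}\Bigr).$$ Claim. Suppose that (almost surely) the graph formed by the edges of non-zero weight is connected, $w_{\max}\le n^2$, $d_{\min}\ge 1$, and $$L\ \ge\ C_1\,\frac{\kappa^4\,w_{\max}\,d_{\max}^4\,\log^2 n}{\lambda_{n-1}(\boldsymbol{L}_w)^5}.$$ Then there is an event of probability at least $1-n^{-10}$ on which the weighted MLE $\widehat\theta$ exists, is unique, and satisfies $$\|\widehat\theta-\theta^\star\|_\infty\ \le\ C_2\,\kappa\,\sqrt{\frac{w_{\max}\log n}{\lambda_{n-1}(\boldsymbol{L}_w)\,L}}.$$ Moreover, on the same event, for every $1\le K<n$ such that $\Delta_K:=\theta^\star_K-\theta^\star_{K+1}>0$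 and $$L\ \ge\ C_3\,\frac{\kappa^2\,w_{\max}\log n}{\lambda_{n-1}(\boldsymbol{L}_w)\,\Delta_K^2},$$ the top-$K$ items are recovered exactly: $\{1,\dots,K\}$ is the only set of $K$ items that can be selected as the $K$ largest entries of $\widehat\theta$. -/

import Mathlib

open MeasureTheory ProbabilityTheory

/-- `κ = exp θ₁ / exp θₙ` for scores listed in decreasing order. -/
noncomputable def condNumber {n : ℕ} (hn : 2 ≤ n) (θ : Fin n → ℝ) : ℝ :=
  Real.exp (θ ⟨0, by omega⟩) / Real.exp (θ ⟨n - 1, by omega⟩)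

/-- `Δ_K = θ_K - θ_{K+1}` (items numbered from `1`, hence the index shift). -/
def scoreGap {n : ℕ} (θ : Fin n → ℝ) (K : ℕ) (hK : K < n) : ℝ :=
  θ ⟨K - 1, by omega⟩ - θ ⟨K, hK⟩

/-- Nonnegative symmetric weights supported on the edges of `G`. -/
structure IsWeighting {n : ℕ} (G : SimpleGraph (Fin n)) (w : Fin n → Fin n → ℝ) : Prop where
  symm : ∀ i j, w i j = w j i
  nonneg : ∀ i j, 0 ≤ w i j
  supported : ∀ i j, ¬ G.Adj i j → w i j = 0

/-- The graph formed by the pairs of non-zero weight. -/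
def supportGraph {n : ℕ} (w : Fin n → Fin n → ℝ) : SimpleGraph (Fin n) :=
  SimpleGraph.fromRel fun i j => w i j ≠ 0

/-- The largest weight. -/
noncomputable def wMax {n : ℕ} (w : Fin n → Fin n → ℝ) : ℝ :=
  ⨆ p : Fin n × Fin n, w p.1 p.2

/-- The weighted degree of `i`. -/
def wDegree {n : ℕ} (w : Fin n → Fin n → ℝ) (i : Fin n) : ℝ :=
  ∑ j ∈ Finset.univ.filter (fun j => j ≠ i), w i j

/-- The largest weighted degree. -/
noncomputable def dMax {n : ℕ} (w : Fin n → Fin n → ℝ) : ℝ := ⨆ i, wDegree w i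

/-- The smallest weighted degree. -/
noncomputable def dMin {n : ℕ} (w : Fin n → Fin n → ℝ) : ℝ := ⨅ i, wDegree w i

/-- The vector `e_i - e_j`. -/
def edgeVec {n : ℕ} (i j : Fin n) : Fin n → ℝ := Pi.single i 1 - Pi.single j 1

/-- The weighted Laplacian `∑_{i > j} w_ij (e_i - e_j)(e_i - e_j)ᵀ`. -/
def wLaplacian {n : ℕ} (w : Fin n → Fin n → ℝ) : Matrix (Fin n) (Fin n) ℝ :=
  ∑ i, ∑ j ∈ Finset.univ.filter (fun j => j < i),
    w i j • Matrix.vecMulVec (edgeVec i j) (edgeVec i j)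

theorem wLaplacian_isHermitian {n : ℕ} (w : Fin n → Fin n → ℝ) :
    (wLaplacian w).IsHermitian := by
  ext a b
  simp [wLaplacian, Matrix.sum_apply, Matrix.vecMulVec_apply, mul_comm]

/-- `λ_{n-1}`, the second smallest eigenvalue of the weighted Laplacian: `eigenvalues₀` lists the
eigenvalues with multiplicity in decreasing order, numbered from `0`. -/
noncomputable def spectralGap {n : ℕ} (hn : 2 ≤ n) (w : Fin n → Fin n → ℝ) : ℝ :=
  (wLaplacian_isHermitian w).eigenvalues₀ ⟨n - 2, by rw [Fintype.card_fin]; omega⟩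

/-- Index of an observed comparison: an edge `(i, j)` of `G` with `i > j`, and a repetition. -/
abbrev ComparisonIdx {n : ℕ} (G : SimpleGraph (Fin n)) (L : ℕ) : Type :=
  {p : Fin n × Fin n // p.2 < p.1 ∧ G.Adj p.1 p.2} × Fin L

/-- The family of all observed outcomes, as one random element. -/
def observed {n L : ℕ} {Ω : Type*} (G : SimpleGraph (Fin n))
    (y : Fin n → Fin n → Fin L → Ω → Bool) (ω : Ω) : ComparisonIdx G L → Bool :=
  fun q => y q.1.1.1 q.1.1.2 q.2 ω

/-- Under the Bradley-Terry-Luce model with scores `θ`, on every edge `(i, j)`, `i > j`, of the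
comparison graph there are `L` outcomes; all of them are independent, and each is `true` (item `j`
beats item `i`) with probability `exp θ_j / (exp θ_i + exp θ_j)`. Nothing is required of
`y i j l` if `(i, j)` is not such an edge. -/
structure IsBTLSample {n L : ℕ} {Ω : Type*} [MeasurableSpace Ω] (μ : Measure Ω)
    (G : SimpleGraph (Fin n)) (θ : Fin n → ℝ) (y : Fin n → Fin n → Fin L → Ω → Bool) : Prop where
  measurable : ∀ i j l, j < i → G.Adj i j → Measurable (y i j l)
  prob : ∀ i j l, j < i → G.Adj i j →
    μ.real {ω | y i j l ω = true} =
      Real.exp (θ j) / (Real.exp (θ i) + Real.exp (θ j))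
  indep : iIndepFun (fun (q : ComparisonIdx G L) (ω : Ω) => observed G y ω q) μ

/-- For `i > j`, the number `y_ji = 1 - y_ij`: it is `1` if item `i` beats item `j`, and `0`
otherwise. -/
def winRev (b : Bool) : ℝ := if b = true then 0 else 1

/-- The weighted negative log-likelihood. -/
noncomputable def wLoss {n L : ℕ} (w : Fin n → Fin n → ℝ) (y : Fin n → Fin n → Fin L → Bool)
    (θ : Fin n → ℝ) : ℝ :=
  -(1 / (L : ℝ)) * ∑ i, ∑ j ∈ Finset.univ.filter (fun j => j < i), ∑ l, w i j *
    Real.log (winRev (y i j l) * (Real.exp (θ i) / (Real.exp (θ i) + Real.exp (θ j))) +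
      (1 - winRev (y i j l)) * (Real.exp (θ j) / (Real.exp (θ i) + Real.exp (θ j))))

/-- `θ` minimizes the weighted negative log-likelihood among the vectors with zero sum. -/
def IsWeightedMLE {n L : ℕ} (w : Fin n → Fin n → ℝ) (y : Fin n → Fin n → Fin L → Bool)
    (θ : Fin n → ℝ) : Prop :=
  ∑ i, θ i = 0 ∧ IsMinOn (wLoss w y) {θ' | ∑ i, θ' i = 0} θ

/-- `S` is a possible choice of `K` largest entries of `θ`. -/
def IsTopSelection {n : ℕ} (θ : Fin n → ℝ) (K : ℕ) (S : Finset (Fin n)) : Prop :=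
  S.card = K ∧ ∀ i ∈ S, ∀ j ∉ S, θ j ≤ θ i

/-- Selecting the `K` largest entries of `θ` is unambiguous and returns the first `K` items. -/
def RecoversTop {n : ℕ} (θ : Fin n → ℝ) (K : ℕ) : Prop :=
  ∀ S : Finset (Fin n), IsTopSelection θ K S ↔ S = Finset.univ.filter (fun i : Fin n => (i : ℕ) < K)

/-!
The estimator is compared with one Newton step from the true scores `θ`. Both the Hessian there and
the Laplacian of `w` are graph Laplacians, comparable up to the factor `4 κ`, so the Newton step is
the Poisson solution for the score and, given the weights, a linear function of independent bounded
noise: it is sub-Gaussian with variance proxy of order `κ² w_max / (λ L)`. Sub-Gaussian vectors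
satisfy tail bounds for diagonal quadratic forms, which control the Newton step `g` entrywise as
well as the weighted norms `∑ i, f k i * g i ^ 2`, where `f k` is the flow of the Green function
with pole `k`.

The maximum likelihood estimator is `θ + g + h`, where `h` solves a fixed point equation whose right
hand side is quadratic in `g + h`. Testing it against the Green function with pole `k`, the
quadratic terms are bounded by exactly these weighted norms, and the map is a contraction in the
sup norm as soon as the total flow `∑ i, f k i`, times the bound for the weighted norm, is small.
The total flow is at most of order `d_max * ∑ i, |green k i|`, and the `ℓ¹` norm of the Green
function costs only `log n / λ` rather than the naive `√n / λ`, because a lazy random walk with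
gap `λ / d_max` forgets its start in `(d_max / λ) * log n` steps: this is where the sample size
condition, free of powers of `n`, comes from. Weights independent of the outcomes may be frozen.
-/

namespace BTL

/-! ### Weighted Laplacians -/

section Laplacian

variable {V : Type*} [Fintype V]

theorem sum_mul_sum_of_antisymm {F : V → V → ℝ} (hF : ∀ i j, F i j = -F j i) (u : V → ℝ) :
    ∑ i, u i * ∑ j, F i j = (∑ i, ∑ j, F i j * (u i - u j)) / 2 := by
  have swap : ∑ i, ∑ j, F i j * u j = -∑ i, ∑ j, F i j * u i := by
    rw [Finset.sum_comm]
    simp only [← Finset.sum_neg_distrib, ← neg_mul]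
    exact Finset.sum_congr rfl fun i _ => Finset.sum_congr rfl fun j _ => by rw [hF]
  simp only [mul_sub, Finset.sum_sub_distrib, swap, mul_comm (u _),
    Finset.sum_mul]
  ring

theorem sum_sum_eq_zero_of_antisymm {F : V → V → ℝ} (hF : ∀ i j, F i j = -F j i) :
    ∑ i, ∑ j, F i j = 0 := by
  simpa using sum_mul_sum_of_antisymm hF fun _ => 1

theorem sum_sum_mul_add_of_symm {z : V → V → ℝ} (hz : ∀ i j, z i j = z j i) (u : V → ℝ) :
    ∑ i, ∑ j, z i j * (u i + u j) = 2 * ∑ i, (∑ j, z i j) * u i := by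
  have swap : ∑ i, ∑ j, z i j * u j = ∑ i, ∑ j, z i j * u i := by
    rw [Finset.sum_comm]
    exact Finset.sum_congr rfl fun i _ => Finset.sum_congr rfl fun j _ => by rw [hz]
  simp only [mul_add, Finset.sum_add_distrib, swap, Finset.sum_mul]
  ring

/-- The Laplacian of the weights `z`, as an operator on functions of the vertices. -/
def lap (z : V → V → ℝ) (v : V → ℝ) (i : V) : ℝ :=
  ∑ j, z i j * (v i - v j)

/-- The Dirichlet energy of `v` for the weights `z`; every unordered pair is counted once. -/
noncomputable def energy (z : V → V → ℝ) (v : V → ℝ) : ℝ :=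
  (∑ i, ∑ j, z i j * (v i - v j) ^ 2) / 2

theorem lap_sub_const (z : V → V → ℝ) (v : V → ℝ) (a : ℝ) :
    lap z (fun i => v i - a) = lap z v := by
  funext i
  simp only [lap, sub_sub_sub_cancel_right]

theorem lap_sub (z : V → V → ℝ) (u v : V → ℝ) (i : V) :
    lap z (u - v) i = lap z u i - lap z v i := by
  simp only [lap, Pi.sub_apply, ← Finset.sum_sub_distrib]
  exact Finset.sum_congr rfl fun j _ => by ring

theorem energy_nonneg {z : V → V → ℝ} (h0 : ∀ i j, 0 ≤ z i j) (v : V → ℝ) : 0 ≤ energy z v :=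
  div_nonneg (Finset.sum_nonneg fun i _ => Finset.sum_nonneg fun j _ =>
    mul_nonneg (h0 i j) (sq_nonneg _)) two_pos.le

theorem energy_le_mul_energy {z z' : V → V → ℝ} {c : ℝ} (h : ∀ i j, z i j ≤ c * z' i j)
    (v : V → ℝ) : energy z v ≤ c * energy z' v := by
  simp only [energy, mul_div_assoc', Finset.mul_sum, ← mul_assoc]
  gcongr with i _ j _
  exact h i j

section Symm

variable {z : V → V → ℝ} (hs : ∀ i j, z i j = z j i)
include hs

theorem sum_mul_lap (u v : V → ℝ) :
    ∑ i, u i * lap z v i = (∑ i, ∑ j, z i j * (v i - v j) * (u i - u j)) / 2 :=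
  sum_mul_sum_of_antisymm (F := fun i j => z i j * (v i - v j))
    (fun i j => by rw [hs]; ring) u

theorem sum_mul_lap_comm (u v : V → ℝ) : ∑ i, u i * lap z v i = ∑ i, v i * lap z u i := by
  simp only [sum_mul_lap hs, mul_right_comm]

theorem sum_mul_lap_self (v : V → ℝ) : ∑ i, v i * lap z v i = energy z v := by
  simp only [sum_mul_lap hs, energy, sq, mul_assoc]

theorem sum_lap (v : V → ℝ) : ∑ i, lap z v i = 0 :=
  sum_sum_eq_zero_of_antisymm fun i j => by rw [hs]; ring

variable (h0 : ∀ i j, 0 ≤ z i j) {D : ℝ} (hD : ∀ i, ∑ j, z i j ≤ D)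
include h0 hD

theorem energy_le_of_degree_le (v : V → ℝ) : energy z v ≤ 2 * D * ∑ i, v i ^ 2 := by
  have pairwise_le : ∑ i, ∑ j, z i j * (v i - v j) ^ 2 ≤
      ∑ i, ∑ j, z i j * (2 * v i ^ 2 + 2 * v j ^ 2) := by
    gcongr with i _ j _
    · exact h0 i j
    · nlinarith [sq_nonneg (v i + v j)]
  have degree_le : ∑ i, (∑ j, z i j) * (2 * v i ^ 2) ≤ ∑ i, D * (2 * v i ^ 2) := by
    gcongr with i
    exact hD i
  rw [sum_sum_mul_add_of_symm hs fun i => 2 * v i ^ 2] at pairwise_le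
  simp only [← Finset.mul_sum] at degree_le
  rw [energy]
  linarith

omit hs in
theorem sum_sq_lap_le (v : V → ℝ) : ∑ i, lap z v i ^ 2 ≤ 2 * D * energy z v := by
  have cauchy_schwarz (i : V) : lap z v i ^ 2 ≤ (∑ j, z i j) * ∑ j, z i j * (v i - v j) ^ 2 :=
    Finset.sum_sq_le_sum_mul_sum_of_sq_le_mul Finset.univ (fun j _ => h0 i j)
      (fun j _ => mul_nonneg (h0 i j) (sq_nonneg _)) fun j _ => le_of_eq (by ring)
  calc ∑ i, lap z v i ^ 2 ≤ ∑ i, D * ∑ j, z i j * (v i - v j) ^ 2 := by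
        gcongr with i
        exact (cauchy_schwarz i).trans (mul_le_mul_of_nonneg_right (hD i)
          (Finset.sum_nonneg fun j _ => mul_nonneg (h0 i j) (sq_nonneg _)))
    _ = 2 * D * energy z v := by rw [← Finset.mul_sum, energy]; ring

end Symm

/-- A Poincaré inequality: `l` is at most the second smallest eigenvalue of the Laplacian of
`z`. -/
def HasGap (z : V → V → ℝ) (l : ℝ) : Prop :=
  ∀ v : V → ℝ, ∑ i, v i = 0 → l * ∑ i, v i ^ 2 ≤ energy z v

section Gap

variable {z : V → V → ℝ} {l : ℝ}

theorem HasGap.eq_zero_of_energy_le_zero (hz : HasGap z l) (hl : 0 < l) {v : V → ℝ}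
    (hv : ∑ i, v i = 0) (he : energy z v ≤ 0) : v = 0 := by
  have sum_sq_eq_zero : ∑ i, v i ^ 2 = 0 :=
    le_antisymm (nonpos_of_mul_nonpos_right ((hz v hv).trans he) hl)
      (Finset.sum_nonneg fun i _ => sq_nonneg _)
  funext i
  exact pow_eq_zero_iff two_ne_zero |>.1 <|
    (Finset.sum_eq_zero_iff_of_nonneg fun i _ => sq_nonneg (v i)).1 sum_sq_eq_zero i
      (Finset.mem_univ i)

variable (hs : ∀ i j, z i j = z j i) (hl : 0 < l) (hz : HasGap z l)
include hs hl hz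

theorem eq_zero_of_lap_eq_zero {v : V → ℝ} (hv : ∑ i, v i = 0) (hlap : ∀ i, lap z v i = 0) :
    v = 0 := by
  refine hz.eq_zero_of_energy_le_zero hl hv ?_
  simp only [← sum_mul_lap_self hs, hlap, mul_zero, Finset.sum_const_zero, le_refl]

theorem energy_le_of_lap_eq {u t : V → ℝ} {m : ℝ} (hu : ∑ i, u i = 0)
    (ht : ∀ i, lap z u i = t i - m) : energy z u ≤ (∑ i, t i ^ 2) / l := by
  have energy_eq : energy z u = ∑ i, u i * t i := by
    simp only [← sum_mul_lap_self hs, ht, mul_sub, Finset.sum_sub_distrib, ← Finset.sum_mul, hu,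
      zero_mul, sub_zero]
  have young : ∑ i, u i * t i ≤ ∑ i, (l * u i ^ 2 + t i ^ 2 / l) / 2 := by
    gcongr with i
    have : l * u i ^ 2 + t i ^ 2 / l - 2 * (u i * t i) = (l * u i - t i) ^ 2 / l := by
      field_simp; ring
    linarith [show 0 ≤ (l * u i - t i) ^ 2 / l by positivity]
  have gap := hz u hu
  simp only [← Finset.sum_div, Finset.sum_add_distrib, ← Finset.mul_sum] at young
  linarith

theorem sum_sq_le_of_lap_eq {u t : V → ℝ} {m : ℝ} (hu : ∑ i, u i = 0)
    (ht : ∀ i, lap z u i = t i - m) : ∑ i, u i ^ 2 ≤ (∑ i, t i ^ 2) / l ^ 2 := by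
  rw [sq l, ← div_div, le_div_iff₀' hl]
  exact (hz u hu).trans (energy_le_of_lap_eq hs hl hz hu ht)

end Gap

/-! ### The Poisson equation and the Green function -/

variable [DecidableEq V]

/-- The Laplacian of `z` plus the projection onto the constants. The added projection makes the
matrix invertible as soon as `z` has a positive spectral gap. -/
noncomputable def lapMatrix (z : V → V → ℝ) : Matrix V V ℝ :=
  Matrix.diagonal (fun i => ∑ j, z i j) - Matrix.of z +
    Matrix.of fun _ _ => 1 / (Fintype.card V : ℝ)

/-- The solution `u` of the Poisson equation `lap z u = t - mean t` with `∑ i, u i = 0`. -/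
noncomputable def poisson (z : V → V → ℝ) (t : V → ℝ) (i : V) : ℝ :=
  ((lapMatrix z)⁻¹.mulVec t) i - (∑ j, t j) / Fintype.card V

/-- The Green function of the Laplacian of `z` with pole `k`. -/
noncomputable def green (z : V → V → ℝ) (k : V) : V → ℝ :=
  poisson z (Pi.single k 1)

theorem lapMatrix_mulVec (z : V → V → ℝ) (v : V → ℝ) (i : V) :
    (lapMatrix z).mulVec v i = lap z v i + (∑ j, v j) / Fintype.card V := by
  simp only [lapMatrix, Matrix.add_mulVec, Matrix.sub_mulVec, Pi.add_apply, Pi.sub_apply,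
    Matrix.mulVec_diagonal, lap, mul_sub, Finset.sum_sub_distrib]
  simp only [Matrix.mulVec, dotProduct, Matrix.of_apply, Finset.sum_mul, Finset.sum_div,
    one_div_mul_eq_div]

section Poisson

variable [Nonempty V] {z : V → V → ℝ} {l : ℝ}
variable (hs : ∀ i j, z i j = z j i) (hl : 0 < l) (hz : HasGap z l)
include hs

theorem sum_lapMatrix_mulVec (v : V → ℝ) : ∑ i, (lapMatrix z).mulVec v i = ∑ i, v i := by
  simp only [lapMatrix_mulVec, Finset.sum_add_distrib, sum_lap hs, Finset.sum_const,
    Finset.card_univ, nsmul_eq_mul, zero_add]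
  exact mul_div_cancel₀ _ (Nat.cast_ne_zero.2 Fintype.card_ne_zero)

include hl hz

theorem isUnit_det_lapMatrix : IsUnit (lapMatrix z).det := by
  rw [← Matrix.isUnit_iff_isUnit_det, ← Matrix.mulVec_injective_iff_isUnit]
  refine (injective_iff_map_eq_zero (Matrix.mulVecLin (lapMatrix z))).2 fun v hv => ?_
  have mulVec_eq_zero (i : V) : (lapMatrix z).mulVec v i = 0 := congrFun hv i
  have sum_eq_zero : ∑ i, v i = 0 := by
    rw [← sum_lapMatrix_mulVec hs, Finset.sum_eq_zero fun i _ => mulVec_eq_zero i]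
  refine eq_zero_of_lap_eq_zero hs hl hz sum_eq_zero fun i => ?_
  simpa only [lapMatrix_mulVec, sum_eq_zero, zero_div, add_zero] using mulVec_eq_zero i

theorem lapMatrix_mulVec_inv_mulVec (t : V → ℝ) :
    (lapMatrix z).mulVec ((lapMatrix z)⁻¹.mulVec t) = t := by
  rw [Matrix.mulVec_mulVec, Matrix.mul_nonsing_inv _ (isUnit_det_lapMatrix hs hl hz),
    Matrix.one_mulVec]

theorem sum_inv_lapMatrix_mulVec (t : V → ℝ) :
    ∑ i, ((lapMatrix z)⁻¹.mulVec t) i = ∑ i, t i := by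
  rw [← sum_lapMatrix_mulVec hs, lapMatrix_mulVec_inv_mulVec hs hl hz]

theorem sum_poisson (t : V → ℝ) : ∑ i, poisson z t i = 0 := by
  simp only [poisson, Finset.sum_sub_distrib, sum_inv_lapMatrix_mulVec hs hl hz, Finset.sum_const,
    Finset.card_univ, nsmul_eq_mul]
  rw [mul_div_cancel₀ _ (Nat.cast_ne_zero.2 Fintype.card_ne_zero), sub_self]

theorem lap_poisson (t : V → ℝ) (i : V) :
    lap z (poisson z t) i = t i - (∑ j, t j) / Fintype.card V := by
  have inv_eq := congrFun (lapMatrix_mulVec_inv_mulVec hs hl hz t) i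
  rw [lapMatrix_mulVec, sum_inv_lapMatrix_mulVec hs hl hz] at inv_eq
  rw [← inv_eq, add_sub_cancel_right]
  exact congrFun (lap_sub_const z _ _) i

theorem sum_mul_poisson_comm (s t : V → ℝ) :
    ∑ i, s i * poisson z t i = ∑ i, t i * poisson z s i := by
  have eq_lap (a b : V → ℝ) :
      ∑ i, a i * poisson z b i = ∑ i, poisson z b i * lap z (poisson z a) i := by
    simp only [lap_poisson hs hl hz, mul_sub, Finset.sum_sub_distrib, ← Finset.sum_mul,
      sum_poisson hs hl hz, zero_mul, sub_zero, mul_comm (a _)]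
  rw [eq_lap, sum_mul_lap_comm hs, eq_lap]

theorem poisson_eq_sum_green (t : V → ℝ) (k : V) : poisson z t k = ∑ i, t i * green z k i := by
  simpa only [green, Pi.single_apply, ite_mul, one_mul, zero_mul, Finset.sum_ite_eq',
    Finset.mem_univ, if_true] using sum_mul_poisson_comm hs hl hz (Pi.single k 1) t

theorem energy_poisson_le (t : V → ℝ) : energy z (poisson z t) ≤ (∑ i, t i ^ 2) / l :=
  energy_le_of_lap_eq hs hl hz (sum_poisson hs hl hz t) (lap_poisson hs hl hz t)

theorem sum_sq_green_le (k : V) : ∑ i, green z k i ^ 2 ≤ (1 / l) ^ 2 := by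
  simpa [green, Pi.single_apply] using
    sum_sq_le_of_lap_eq hs hl hz (sum_poisson hs hl hz _) (lap_poisson hs hl hz (Pi.single k 1))

theorem abs_green_le (k i : V) : |green z k i| ≤ 1 / l :=
  abs_le_of_sq_le_sq ((Finset.single_le_sum (f := fun i => green z k i ^ 2)
    (fun _ _ => sq_nonneg _) (Finset.mem_univ i)).trans (sum_sq_green_le hs hl hz k))
    (one_div_nonneg.2 hl.le)

end Poisson

end Laplacian

/-! ### The `ℓ¹` norm of the Green function -/

section LazyWalk

variable {V : Type*} [Fintype V]

/-- One step of the lazy random walk with jump rates `z / (2 * D)`, acting on functions. It is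
defined for all `D`, but meant for `D` at least the largest degree: then every step stays put with
probability at least `1 / 2`. -/
noncomputable def lazyWalk (z : V → V → ℝ) (D : ℝ) (v : V → ℝ) (i : V) : ℝ :=
  v i - lap z v i / (2 * D)

theorem lap_lazyWalk (z : V → V → ℝ) (D : ℝ) (v : V → ℝ) :
    lap z (lazyWalk z D v) = lazyWalk z D (lap z v) := by
  funext i
  change ∑ j, z i j * ((v i - lap z v i / (2 * D)) - (v j - lap z v j / (2 * D))) =
    ∑ j, z i j * (v i - v j) - (∑ j, z i j * (lap z v i - lap z v j)) / (2 * D)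
  rw [Finset.sum_div, ← Finset.sum_sub_distrib]
  exact Finset.sum_congr rfl fun j _ => by ring

variable {z : V → V → ℝ} {D l : ℝ}

theorem gap_le_of_degree_le [Nontrivial V] (hs : ∀ i j, z i j = z j i) (h0 : ∀ i j, 0 ≤ z i j)
    (hD : ∀ i, ∑ j, z i j ≤ D) (hz : HasGap z l) : l ≤ 2 * D := by
  classical
  obtain ⟨a, b, hab⟩ := exists_pair_ne V
  let v : V → ℝ := Pi.single a 1 - Pi.single b 1
  have sum_eq_zero : ∑ i, v i = 0 := by simp [v, Finset.sum_sub_distrib]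
  have sum_sq_pos : 0 < ∑ i, v i ^ 2 :=
    Finset.sum_pos' (fun i _ => sq_nonneg _) ⟨a, Finset.mem_univ a, by simp [v, hab]⟩
  exact le_of_mul_le_mul_right
    ((hz v sum_eq_zero).trans (energy_le_of_degree_le hs h0 hD v)) sum_sq_pos

theorem abs_lazyWalk_le (h0 : ∀ i j, 0 ≤ z i j) (hD0 : 0 < D) (hD : ∀ i, ∑ j, z i j ≤ D)
    (v : V → ℝ) (i : V) :
    |lazyWalk z D v i| ≤ (1 - (∑ j, z i j) / (2 * D)) * |v i| + ∑ j, z i j / (2 * D) * |v j| := by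
  have holding_nonneg : 0 ≤ 1 - (∑ j, z i j) / (2 * D) := by
    rw [sub_nonneg, div_le_one (by positivity)]
    linarith [hD i]
  have averaging : lazyWalk z D v i =
      (1 - (∑ j, z i j) / (2 * D)) * v i + ∑ j, z i j / (2 * D) * v j := by
    simp only [lazyWalk, lap, mul_sub, Finset.sum_sub_distrib, ← Finset.sum_mul,
      div_mul_eq_mul_div, ← Finset.sum_div]
    ring
  rw [averaging]
  refine (abs_add_le _ _).trans (add_le_add ?_ ((Finset.abs_sum_le_sum_abs _ _).trans ?_))
  · rw [abs_mul, abs_of_nonneg holding_nonneg]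
  · gcongr with j
    rw [abs_mul, abs_of_nonneg (div_nonneg (h0 i j) (by positivity))]

variable (hs : ∀ i j, z i j = z j i)
include hs

theorem sum_iterate_lazyWalk (v : V → ℝ) (t : ℕ) :
    ∑ i, (lazyWalk z D)^[t] v i = ∑ i, v i := by
  induction t with
  | zero => rfl
  | succ t ih =>
    rw [← ih, Function.iterate_succ_apply']
    simp only [lazyWalk, Finset.sum_sub_distrib, ← Finset.sum_div, sum_lap hs, zero_div, sub_zero]

variable (h0 : ∀ i j, 0 ≤ z i j) (hD0 : 0 < D) (hD : ∀ i, ∑ j, z i j ≤ D)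
include h0 hD0 hD

theorem sum_abs_lazyWalk_le (v : V → ℝ) : ∑ i, |lazyWalk z D v i| ≤ ∑ i, |v i| := by
  refine (Finset.sum_le_sum fun i _ => abs_lazyWalk_le h0 hD0 hD v i).trans (le_of_eq ?_)
  rw [Finset.sum_add_distrib, Finset.sum_comm (f := fun i j => z i j / (2 * D) * |v j|),
    ← Finset.sum_add_distrib]
  refine Finset.sum_congr rfl fun i _ => ?_
  rw [← Finset.sum_mul, ← Finset.sum_div, Finset.sum_congr rfl fun j _ => hs j i]
  ring

theorem sum_abs_lap_iterate_lazyWalk_le (v : V → ℝ) (t : ℕ) :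
    ∑ i, |lap z ((lazyWalk z D)^[t] v) i| ≤ ∑ i, |lap z v i| := by
  induction t with
  | zero => rfl
  | succ t ih =>
    rw [Function.iterate_succ_apply', lap_lazyWalk]
    exact (sum_abs_lazyWalk_le hs h0 hD0 hD _).trans ih

theorem sum_abs_le_sum_abs_iterate_lazyWalk_add (v : V → ℝ) (t : ℕ) :
    ∑ i, |v i| ≤ ∑ i, |(lazyWalk z D)^[t] v i| + t * ((∑ i, |lap z v i|) / (2 * D)) := by
  induction t with
  | zero => simp
  | succ t ih =>
    set u := (lazyWalk z D)^[t] v with hu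
    have one_step (i : V) : |u i| ≤ |lazyWalk z D u i| + |lap z u i| / (2 * D) := by
      have split : u i = lazyWalk z D u i + lap z u i / (2 * D) := (sub_add_cancel _ _).symm
      nth_rw 1 [split]
      refine (abs_add_le _ _).trans_eq ?_
      rw [abs_div, abs_of_pos (by positivity : 0 < 2 * D)]
    have sum_one_step := Finset.sum_le_sum fun i (_ : i ∈ Finset.univ) => one_step i
    have lap_le : (∑ i, |lap z u i|) / (2 * D) ≤ (∑ i, |lap z v i|) / (2 * D) :=
      div_le_div_of_nonneg_right (sum_abs_lap_iterate_lazyWalk_le hs h0 hD0 hD v t) (by positivity)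
    rw [Finset.sum_add_distrib, ← Finset.sum_div] at sum_one_step
    rw [Function.iterate_succ_apply', ← hu]
    push_cast
    linarith

variable (hz : HasGap z l)
include hz

theorem sum_sq_lazyWalk_le {v : V → ℝ} (hv : ∑ i, v i = 0) :
    ∑ i, lazyWalk z D v i ^ 2 ≤ (1 - l / (2 * D)) * ∑ i, v i ^ 2 := by
  have expand : ∑ i, lazyWalk z D v i ^ 2 =
      ∑ i, v i ^ 2 - energy z v / D + (∑ i, lap z v i ^ 2) / (2 * D) ^ 2 := by
    rw [← sum_mul_lap_self hs, Finset.sum_div, Finset.sum_div, ← Finset.sum_sub_distrib,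
      ← Finset.sum_add_distrib]
    refine Finset.sum_congr rfl fun i _ => ?_
    rw [lazyWalk]
    field_simp
    ring
  have lap_le : (∑ i, lap z v i ^ 2) / (2 * D) ^ 2 ≤ energy z v / (2 * D) := by
    rw [div_le_div_iff₀ (by positivity) (by positivity)]
    nlinarith [sum_sq_lap_le h0 hD v]
  have gap : l / (2 * D) * ∑ i, v i ^ 2 ≤ energy z v / (2 * D) := by
    rw [div_mul_eq_mul_div]
    exact div_le_div_of_nonneg_right (hz v hv) (by positivity)
  have halve : energy z v / D = energy z v / (2 * D) + energy z v / (2 * D) := by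
    field_simp
    ring
  linarith

theorem sum_sq_iterate_lazyWalk_le (hlD : l ≤ 2 * D) {v : V → ℝ} (hv : ∑ i, v i = 0) (t : ℕ) :
    ∑ i, (lazyWalk z D)^[t] v i ^ 2 ≤ (1 - l / (2 * D)) ^ t * ∑ i, v i ^ 2 := by
  induction t with
  | zero => simp
  | succ t ih =>
    rw [Function.iterate_succ_apply', pow_succ', mul_assoc]
    refine (sum_sq_lazyWalk_le hs h0 hD0 hD hz
      ((sum_iterate_lazyWalk hs v t).trans hv)).trans (mul_le_mul_of_nonneg_left ih ?_)
    exact sub_nonneg.2 ((div_le_one (by positivity)).2 hlD)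

end LazyWalk

theorem exists_one_sub_pow_le_inv {q N : ℝ} (hq : 0 < q) (hq1 : q ≤ 1) (hN : 1 ≤ N) :
    ∃ t : ℕ, (1 - q) ^ t ≤ 1 / N ∧ (t : ℝ) ≤ Real.log N / q + 1 := by
  have hN0 : 0 < N := one_pos.trans_le hN
  refine ⟨⌈Real.log N / q⌉₊, ?_, (Nat.ceil_lt_add_one (div_nonneg (Real.log_nonneg hN) hq.le)).le⟩
  have log_le : Real.log N ≤ ⌈Real.log N / q⌉₊ * q := (div_le_iff₀ hq).1 (Nat.le_ceil _)
  calc (1 - q) ^ ⌈Real.log N / q⌉₊ ≤ Real.exp (-q) ^ ⌈Real.log N / q⌉₊ := by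
        exact pow_le_pow_left₀ (sub_nonneg.2 hq1) (Real.one_sub_le_exp_neg q) _
    _ = Real.exp (-(⌈Real.log N / q⌉₊ * q)) := by rw [← Real.exp_nat_mul, mul_neg]
    _ ≤ Real.exp (-Real.log N) := by gcongr
    _ = 1 / N := by rw [Real.exp_neg, Real.exp_log hN0, one_div]

section GreenL1

variable {V : Type*} [Fintype V] [Nontrivial V] {z : V → V → ℝ} {D l : ℝ}
variable (hs : ∀ i j, z i j = z j i) (h0 : ∀ i j, 0 ≤ z i j)
variable (hD0 : 0 < D) (hD : ∀ i, ∑ j, z i j ≤ D) (hl : 0 < l) (hz : HasGap z l)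
include hs h0 hD0 hD hl hz

/- The walk is run until the spectral gap has reduced the `ℓ²` norm by the factor `√(card V)` lost
in comparing the `ℓ¹` and `ℓ²` norms. -/
theorem sum_abs_le_of_sum_eq_zero {v : V → ℝ} (hv : ∑ i, v i = 0) :
    ∑ i, |v i| ≤
      √(∑ i, v i ^ 2) + (Real.log (Fintype.card V) / l + 1 / (2 * D)) * ∑ i, |lap z v i| := by
  have one_le_card : (1 : ℝ) ≤ Fintype.card V := by exact_mod_cast Fintype.card_pos
  have : (0 : ℝ) < Fintype.card V := one_pos.trans_le one_le_card
  have hlD : l ≤ 2 * D := gap_le_of_degree_le hs h0 hD hz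
  obtain ⟨t, decay, t_le⟩ := exists_one_sub_pow_le_inv (q := l / (2 * D)) (by positivity)
    ((div_le_one (by positivity)).2 hlD) one_le_card
  have late : ∑ i, |(lazyWalk z D)^[t] v i| ≤ √(∑ i, v i ^ 2) := by
    refine Real.le_sqrt_of_sq_le ?_
    calc (∑ i, |(lazyWalk z D)^[t] v i|) ^ 2
        ≤ Fintype.card V * ∑ i, (lazyWalk z D)^[t] v i ^ 2 := by
          simpa only [sq_abs, Finset.card_univ] using
            sq_sum_le_card_mul_sum_sq (s := Finset.univ) (f := fun i => |(lazyWalk z D)^[t] v i|)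
      _ ≤ Fintype.card V * (1 / Fintype.card V * ∑ i, v i ^ 2) := by
          gcongr
          exact (sum_sq_iterate_lazyWalk_le hs h0 hD0 hD hz hlD hv t).trans (by gcongr)
      _ = ∑ i, v i ^ 2 := by field_simp
  have early : t * ((∑ i, |lap z v i|) / (2 * D)) ≤
      (Real.log (Fintype.card V) / l + 1 / (2 * D)) * ∑ i, |lap z v i| := by
    calc t * ((∑ i, |lap z v i|) / (2 * D))
        ≤ (Real.log (Fintype.card V) / (l / (2 * D)) + 1) * ((∑ i, |lap z v i|) / (2 * D)) := by
          gcongr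
      _ = _ := by field_simp
  linarith [sum_abs_le_sum_abs_iterate_lazyWalk_add hs h0 hD0 hD v t]

variable [DecidableEq V]

omit h0 hD0 hD in
theorem sum_abs_lap_green_le (k : V) : ∑ i, |lap z (green z k) i| ≤ 2 := by
  have card_pos : (0 : ℝ) < Fintype.card V := by exact_mod_cast Fintype.card_pos
  have abs_le (i : V) :
      |lap z (green z k) i| ≤ (Pi.single k 1 : V → ℝ) i + 1 / Fintype.card V := by
    rw [green, lap_poisson hs hl hz, Finset.sum_pi_single', if_pos (Finset.mem_univ k)]
    refine (abs_sub _ _).trans_eq ?_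
    rw [abs_of_nonneg (by rw [Pi.single_apply]; positivity), abs_of_nonneg (by positivity)]
  refine (Finset.sum_le_sum fun i _ => abs_le i).trans_eq ?_
  rw [Finset.sum_add_distrib, Finset.sum_pi_single', if_pos (Finset.mem_univ k), Finset.sum_const,
    Finset.card_univ, nsmul_eq_mul, mul_one_div_cancel card_pos.ne']
  norm_num

theorem sum_abs_green_le (k : V) :
    ∑ i, |green z k i| ≤ 7 * Real.log (Fintype.card V) / l := by
  have log_ge : 0.6 ≤ Real.log (Fintype.card V) := by
    have : Real.log 2 ≤ Real.log (Fintype.card V) :=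
      Real.log_le_log two_pos (by exact_mod_cast Fintype.one_lt_card)
    linarith [Real.log_two_gt_d9]
  have sqrt_le : √(∑ i, green z k i ^ 2) ≤ 1 / l :=
    Real.sqrt_le_iff.2 ⟨by positivity, sum_sq_green_le hs hl hz k⟩
  have inv_le : 1 / (2 * D) ≤ 1 / l :=
    one_div_le_one_div_of_le hl (gap_le_of_degree_le hs h0 hD hz)
  calc ∑ i, |green z k i|
      ≤ 1 / l + (Real.log (Fintype.card V) / l + 1 / l) * 2 := by
        refine (sum_abs_le_of_sum_eq_zero hs h0 hD0 hD hl hz (sum_poisson hs hl hz _)).trans ?_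
        gcongr
        · exact sqrt_le
        · exact sum_abs_lap_green_le hs hl hz k
    _ = (3 + 2 * Real.log (Fintype.card V)) / l := by ring
    _ ≤ 7 * Real.log (Fintype.card V) / l := by
        gcongr
        linarith

end GreenL1

/-! ### Quadratic forms of sub-Gaussian vectors -/

section GaussianMoments

theorem lintegral_exp_mul_gaussianReal (a : ℝ) :
    ∫⁻ x, ENNReal.ofReal (Real.exp (a * x)) ∂(gaussianReal 0 1) =
      ENNReal.ofReal (Real.exp (a ^ 2 / 2)) := by
  rw [← ofReal_integral_eq_lintegral_ofReal (integrable_exp_mul_gaussianReal a)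
    (Filter.Eventually.of_forall fun x => (Real.exp_pos _).le)]
  congr 1
  simpa [mgf] using congrFun (mgf_id_gaussianReal (μ := 0) (v := 1)) a

theorem one_div_one_sub_le_exp {x : ℝ} (h0 : 0 ≤ x) (h1 : x ≤ 1 / 2) :
    1 / (1 - x) ≤ Real.exp (2 * x) := by
  rw [div_le_iff₀ (by linarith)]
  nlinarith [Real.add_one_le_exp (2 * x)]

theorem lintegral_exp_mul_sq_gaussianReal {a : ℝ} (ha : a < 1 / 2) :
    ∫⁻ x, ENNReal.ofReal (Real.exp (a * x ^ 2)) ∂(gaussianReal 0 1) =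
      ENNReal.ofReal √(1 / (1 - 2 * a)) := by
  have hb : 0 < 1 / 2 - a := by linarith
  have density_mul (x : ℝ) :
      (gaussianPDF 0 1 * fun x => ENNReal.ofReal (Real.exp (a * x ^ 2))) x =
        ENNReal.ofReal ((√(2 * Real.pi))⁻¹ * Real.exp (-(1 / 2 - a) * x ^ 2)) := by
    rw [Pi.mul_apply, gaussianPDF, ← ENNReal.ofReal_mul (gaussianPDFReal_nonneg _ _ _),
      gaussianPDFReal, mul_assoc, ← Real.exp_add]
    simp only [NNReal.coe_one, mul_one, sub_zero]
    congr 3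
    ring
  rw [gaussianReal_of_var_ne_zero _ one_ne_zero,
    lintegral_withDensity_eq_lintegral_mul _ (measurable_gaussianPDF _ _) (by fun_prop),
    lintegral_congr density_mul,
    ← ofReal_integral_eq_lintegral_ofReal ((integrable_exp_neg_mul_sq hb).const_mul _)
      (Filter.Eventually.of_forall fun x => by positivity),
    integral_const_mul, integral_gaussian, ← Real.sqrt_inv, ← Real.sqrt_mul (by positivity)]
  congr 2
  have : 1 - 2 * a ≠ 0 := by linarith
  field_simp

theorem lintegral_exp_mul_sq_gaussianReal_le {a : ℝ} (h0 : 0 ≤ a) (h1 : a ≤ 1 / 4) :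
    ∫⁻ x, ENNReal.ofReal (Real.exp (a * x ^ 2)) ∂(gaussianReal 0 1) ≤
      ENNReal.ofReal (Real.exp (2 * a)) := by
  rw [lintegral_exp_mul_sq_gaussianReal (by linarith)]
  refine ENNReal.ofReal_le_ofReal ((Real.sqrt_le_left (Real.exp_pos _).le).2 ?_)
  rw [← Real.exp_nat_mul, Nat.cast_two]
  exact one_div_one_sub_le_exp (by linarith) (by linarith)

theorem lintegral_pi_prod {ι E : Type*} [Fintype ι] [MeasurableSpace E] (ν : Measure E)
    [IsProbabilityMeasure ν] {f : ι → E → ENNReal} (hf : ∀ i, Measurable (f i)) :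
    ∫⁻ x, ∏ i, f i (x i) ∂(Measure.pi fun _ : ι => ν) = ∏ i, ∫⁻ x, f i x ∂ν := by
  rw [lintegral_prod_eq_prod_lintegral_of_indepFun (μ := Measure.pi fun _ : ι => ν)
    Finset.univ (fun i (x : ι → E) => f i (x i))
    (iIndepFun_pi (X := fun i => f i) fun i => (hf i).aemeasurable)
    (fun i => (hf i).comp (measurable_pi_apply i))]
  exact Finset.prod_congr rfl fun i _ =>
    (measurePreserving_eval (fun _ : ι => ν) i).lintegral_comp (hf i)

theorem ofReal_exp_sum {ι : Type*} [Fintype ι] (f : ι → ℝ) :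
    ENNReal.ofReal (Real.exp (∑ i, f i)) = ∏ i, ENNReal.ofReal (Real.exp (f i)) := by
  rw [Real.exp_sum, ENNReal.ofReal_prod_of_nonneg fun i _ => (Real.exp_pos _).le]

end GaussianMoments

section QuadraticForms

variable {ι : Type*} [Fintype ι]

/- The Hubbard-Stratonovich transform: a quadratic exponential is a Gaussian average of linear
ones. -/
theorem ofReal_exp_sum_mul_sq {c : ι → ℝ} (hc : ∀ i, 0 ≤ c i) (g : ι → ℝ) :
    ENNReal.ofReal (Real.exp (∑ i, c i * g i ^ 2)) =
      ∫⁻ x, ENNReal.ofReal (Real.exp (∑ i, √(2 * c i) * x i * g i))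
        ∂(Measure.pi fun _ : ι => gaussianReal 0 1) := by
  simp only [ofReal_exp_sum]
  rw [lintegral_pi_prod (gaussianReal 0 1)
    (f := fun i x => ENNReal.ofReal (Real.exp (√(2 * c i) * x * g i))) fun i => by fun_prop]
  refine Finset.prod_congr rfl fun i _ => ?_
  have gaussian_moment := lintegral_exp_mul_gaussianReal (√(2 * c i) * g i)
  rw [mul_pow, Real.sq_sqrt (mul_nonneg two_pos.le (hc i)), mul_assoc,
    mul_div_cancel_left₀ _ two_ne_zero] at gaussian_moment
  rw [← gaussian_moment]
  exact lintegral_congr fun x => by rw [mul_right_comm]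

variable {Ω : Type*} [MeasurableSpace Ω] {μ : Measure Ω} {g : Ω → ι → ℝ} {s : ℝ}

/-- All linear forms of the random vector `g` are sub-Gaussian: the moment generating function of
`∑ i, t i * g i` is at most that of a centered Gaussian of variance `s * ∑ i, t i ^ 2`. -/
def IsSubGaussianVector (μ : Measure Ω) (g : Ω → ι → ℝ) (s : ℝ) : Prop :=
  ∀ t : ι → ℝ, ∫⁻ ω, ENNReal.ofReal (Real.exp (∑ i, t i * g ω i)) ∂μ ≤
    ENNReal.ofReal (Real.exp (s * (∑ i, t i ^ 2) / 2))

theorem IsSubGaussianVector.lintegral_exp_sum_mul_sq_le [SFinite μ]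
    (hsub : IsSubGaussianVector μ g s) (hg : Measurable g) (hs : 0 ≤ s) {c : ι → ℝ}
    (hc : ∀ i, 0 ≤ c i) (hsc : ∀ i, s * c i ≤ 1 / 4) :
    ∫⁻ ω, ENNReal.ofReal (Real.exp (∑ i, c i * g ω i ^ 2)) ∂μ ≤
      ENNReal.ofReal (Real.exp (2 * s * ∑ i, c i)) := by
  have linear_moment_le (x : ι → ℝ) :
      ∫⁻ ω, ENNReal.ofReal (Real.exp (∑ i, √(2 * c i) * x i * g ω i)) ∂μ ≤
        ∏ i, ENNReal.ofReal (Real.exp (s * c i * x i ^ 2)) := by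
    refine (hsub fun i => √(2 * c i) * x i).trans_eq ?_
    rw [← ofReal_exp_sum, Finset.mul_sum, Finset.sum_div]
    congr 2
    refine Finset.sum_congr rfl fun i _ => ?_
    rw [mul_pow, Real.sq_sqrt (mul_nonneg two_pos.le (hc i))]
    ring
  have hgi (i : ι) : Measurable fun ω => g ω i := (measurable_pi_apply i).comp hg
  simp_rw [ofReal_exp_sum_mul_sq hc]
  rw [lintegral_lintegral_swap (by fun_prop)]
  refine (lintegral_mono linear_moment_le).trans ?_
  rw [lintegral_pi_prod (gaussianReal 0 1)
      (f := fun i x => ENNReal.ofReal (Real.exp (s * c i * x ^ 2))) fun i => by fun_prop,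
    Finset.mul_sum, ofReal_exp_sum]
  refine Finset.prod_le_prod' fun i _ => ?_
  rw [mul_assoc]
  exact lintegral_exp_mul_sq_gaussianReal_le (mul_nonneg hs (hc i)) (hsc i)

theorem IsSubGaussianVector.measure_lt_sum_mul_sq_le [SFinite μ]
    (hsub : IsSubGaussianVector μ g s) (hg : Measurable g) (hs : 0 < s) {c : ι → ℝ}
    (hc : ∀ i, 0 ≤ c i) {C : ℝ} (hC : 0 < C) (hcC : ∀ i, c i ≤ C) (τ : ℝ) :
    μ {ω | 2 * s * ∑ i, c i + 4 * s * C * τ < ∑ i, c i * g ω i ^ 2} ≤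
      ENNReal.ofReal (Real.exp (-τ)) := by
  set η : ℝ := 1 / (4 * s * C) with hη_def
  have hη : 0 < η := by positivity
  have moment_le := hsub.lintegral_exp_sum_mul_sq_le hg hs.le (c := fun i => η * c i)
    (fun i => mul_nonneg hη.le (hc i)) fun i => by
      calc s * (η * c i) = c i / C / 4 := by rw [hη_def]; field_simp
        _ ≤ 1 / 4 := by gcongr; exact (div_le_one hC).2 (hcC i)
  simp only [mul_assoc η, ← Finset.mul_sum] at moment_le
  have markov := meas_ge_le_lintegral_div (μ := μ)
    (f := fun ω => ENNReal.ofReal (Real.exp (η * ∑ i, c i * g ω i ^ 2)))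
    (by fun_prop) (ε := ENNReal.ofReal (Real.exp (2 * s * (η * ∑ i, c i) + τ)))
    (ENNReal.ofReal_pos.2 (Real.exp_pos _)).ne' ENNReal.ofReal_ne_top
  refine (measure_mono fun ω hω => ?_).trans (markov.trans ?_)
  · refine ENNReal.ofReal_le_ofReal (Real.exp_le_exp.2 ?_)
    calc 2 * s * (η * ∑ i, c i) + τ = η * (2 * s * ∑ i, c i + 4 * s * C * τ) := by
          rw [hη_def]; field_simp
      _ ≤ η * ∑ i, c i * g ω i ^ 2 := mul_le_mul_of_nonneg_left (le_of_lt hω) hη.le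
  · refine (ENNReal.div_le_div_right moment_le _).trans_eq ?_
    rw [← ENNReal.ofReal_div_of_pos (Real.exp_pos _), ← Real.exp_sub, sub_add_cancel_left]

theorem IsSubGaussianVector.measure_lt_sq_le [SFinite μ] (hsub : IsSubGaussianVector μ g s)
    (hg : Measurable g) (hs : 0 < s) (k : ι) (τ : ℝ) :
    μ {ω | 2 * s + 4 * s * τ < g ω k ^ 2} ≤ ENNReal.ofReal (Real.exp (-τ)) := by
  classical
  have tail := hsub.measure_lt_sum_mul_sq_le hg hs (c := fun i => if i = k then 1 else 0)
    (fun i => by split_ifs <;> norm_num) one_pos (fun i => by split_ifs <;> norm_num) τ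
  simpa only [ite_mul, one_mul, zero_mul, Finset.sum_ite_eq', Finset.mem_univ, if_true,
    mul_one] using tail

end QuadraticForms

/-! ### The logistic function -/

section Logistic

/-- The derivative of the logistic function. -/
noncomputable def sigmoidDeriv (x : ℝ) : ℝ := Real.sigmoid x * (1 - Real.sigmoid x)

theorem sigmoidDeriv_nonneg (x : ℝ) : 0 ≤ sigmoidDeriv x :=
  mul_nonneg (Real.sigmoid_nonneg x) (sub_nonneg.2 (Real.sigmoid_le_one x))

theorem sigmoidDeriv_le (x : ℝ) : sigmoidDeriv x ≤ 1 / 4 := by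
  rw [sigmoidDeriv]
  nlinarith [sq_nonneg (Real.sigmoid x - 1 / 2)]

theorem sigmoidDeriv_neg (x : ℝ) : sigmoidDeriv (-x) = sigmoidDeriv x := by
  rw [sigmoidDeriv, sigmoidDeriv, Real.sigmoid_neg]
  ring

theorem exp_neg_div_four_le_sigmoidDeriv {x b : ℝ} (h : |x| ≤ b) :
    Real.exp (-b) / 4 ≤ sigmoidDeriv x := by
  wlog hx : 0 ≤ x generalizing x
  · rw [← sigmoidDeriv_neg]
    exact this (by rwa [abs_neg]) (by linarith)
  have sigmoidDeriv_eq : sigmoidDeriv x = Real.sigmoid x ^ 2 * Real.exp (-x) := by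
    rw [sigmoidDeriv, ← Real.sigmoid_neg, ← Real.sigmoid_mul_rexp_neg]
    ring
  have half_le : 1 / 2 ≤ Real.sigmoid x := by
    simpa only [Real.sigmoid_zero, ← one_div] using Real.sigmoid_le hx
  calc Real.exp (-b) / 4 = (1 / 2) ^ 2 * Real.exp (-b) := by ring
    _ ≤ Real.sigmoid x ^ 2 * Real.exp (-x) := by
        gcongr
        exact (le_abs_self x).trans h
    _ = sigmoidDeriv x := sigmoidDeriv_eq.symm

theorem abs_sigmoid_sub_le (x y : ℝ) : |Real.sigmoid x - Real.sigmoid y| ≤ 1 / 4 * |x - y| :=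
  convex_univ.norm_image_sub_le_of_norm_hasDerivWithin_le (f := Real.sigmoid) (f' := sigmoidDeriv)
    (fun t _ => (Real.hasDerivAt_sigmoid t).hasDerivWithinAt)
    (fun t _ => by rw [Real.norm_of_nonneg (sigmoidDeriv_nonneg t)]; exact sigmoidDeriv_le t)
    trivial trivial

theorem abs_sigmoidDeriv_sub_le (x y : ℝ) :
    |sigmoidDeriv x - sigmoidDeriv y| ≤ 1 / 4 * |x - y| := by
  have factor : sigmoidDeriv x - sigmoidDeriv y =
      (Real.sigmoid x - Real.sigmoid y) * (1 - Real.sigmoid x - Real.sigmoid y) := by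
    rw [sigmoidDeriv, sigmoidDeriv]
    ring
  have abs_le_one : |1 - Real.sigmoid x - Real.sigmoid y| ≤ 1 := by
    rw [abs_le]
    constructor <;> linarith [Real.sigmoid_nonneg x, Real.sigmoid_nonneg y, Real.sigmoid_le_one x,
      Real.sigmoid_le_one y]
  rw [factor, abs_mul]
  exact (mul_le_of_le_one_right (abs_nonneg _) abs_le_one).trans (abs_sigmoid_sub_le x y)

/-- The remainder of the first order Taylor expansion of the logistic function at `a`. -/
noncomputable def sigmoidRemainder (a x : ℝ) : ℝ :=
  Real.sigmoid (a + x) - Real.sigmoid a - sigmoidDeriv a * x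

theorem sigmoidRemainder_neg (a x : ℝ) : sigmoidRemainder (-a) (-x) = -sigmoidRemainder a x := by
  rw [sigmoidRemainder, sigmoidRemainder, sigmoidDeriv_neg, ← neg_add, Real.sigmoid_neg,
    Real.sigmoid_neg]
  ring

theorem hasDerivAt_sigmoidRemainder (a x : ℝ) :
    HasDerivAt (sigmoidRemainder a) (sigmoidDeriv (a + x) - sigmoidDeriv a) x := by
  have hasDerivAt_shift : HasDerivAt (fun x => Real.sigmoid (a + x)) (sigmoidDeriv (a + x)) x :=
    (Real.hasDerivAt_sigmoid (a + x)).comp_const_add a x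
  have hasDerivAt_linear : HasDerivAt (fun x => sigmoidDeriv a * x) (sigmoidDeriv a) x :=
    hasDerivAt_const_mul (sigmoidDeriv a)
  exact (hasDerivAt_shift.sub_const _).sub hasDerivAt_linear

theorem abs_sigmoidRemainder_sub_le (a x y : ℝ) :
    |sigmoidRemainder a x - sigmoidRemainder a y| ≤ 1 / 4 * (|x| + |y|) * |x - y| := by
  refine (convex_Icc (-(|x| + |y|)) (|x| + |y|)).norm_image_sub_le_of_norm_hasDerivWithin_le
    (fun t _ => (hasDerivAt_sigmoidRemainder a t).hasDerivWithinAt) (fun t ht => ?_)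
    (abs_le.1 (by linarith [abs_nonneg x])) (abs_le.1 (by linarith [abs_nonneg y]))
  refine (abs_sigmoidDeriv_sub_le _ _).trans ?_
  rw [add_sub_cancel_left]
  gcongr
  exact abs_le.2 ht

theorem abs_sigmoidRemainder_le (a x : ℝ) : |sigmoidRemainder a x| ≤ 1 / 4 * x ^ 2 := by
  have remainder_zero : sigmoidRemainder a 0 = 0 := by simp [sigmoidRemainder]
  simpa only [remainder_zero, sub_zero, abs_zero, add_zero, mul_assoc, ← sq, sq_abs] using
    abs_sigmoidRemainder_sub_le a x 0

/-- The function `x ↦ log (1 + exp x)`, a primitive of the logistic function. -/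
noncomputable def softplus (x : ℝ) : ℝ := Real.log (1 + Real.exp x)

theorem softplus_sub_softplus_neg (x : ℝ) : softplus x - softplus (-x) = x := by
  have factor : 1 + Real.exp x = Real.exp x * (1 + Real.exp (-x)) := by
    rw [mul_add, ← Real.exp_add, add_neg_cancel, Real.exp_zero, mul_one, add_comm]
  rw [softplus, softplus, factor, Real.log_mul (by positivity) (by positivity), Real.log_exp]
  ring

/- The tangent line inequality, in the form of Jensen's inequality for `exp` at `0` and `y - x` with
weights `1 - sigmoid x` and `sigmoid x`. -/
theorem softplus_add_sigmoid_mul_lt {x y : ℝ} (h : x ≠ y) :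
    softplus x + Real.sigmoid x * (y - x) < softplus y := by
  have jensen := strictConvexOn_exp.2 (Set.mem_univ (0 : ℝ)) (Set.mem_univ (y - x))
    (sub_ne_zero.2 h.symm).symm (sub_pos.2 (Real.sigmoid_lt_one x)) (Real.sigmoid_pos x) (by ring)
  have mean_eq : 1 - Real.sigmoid x + Real.sigmoid x * Real.exp (y - x) =
      (1 + Real.exp y) / (1 + Real.exp x) := by
    rw [Real.sigmoid_def, Real.exp_sub, Real.exp_neg]
    field_simp
    ring
  simp only [smul_eq_mul, mul_zero, zero_add, Real.exp_zero, mul_one] at jensen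
  rw [mean_eq, ← Real.lt_log_iff_exp_lt (by positivity),
    Real.log_div (by positivity) (by positivity)] at jensen
  exact lt_sub_iff_add_lt'.1 jensen

theorem softplus_add_sigmoid_mul_le (x y : ℝ) :
    softplus x + Real.sigmoid x * (y - x) ≤ softplus y := by
  rcases eq_or_ne x y with rfl | h
  · rw [sub_self, mul_zero, add_zero]
  · exact (softplus_add_sigmoid_mul_lt h).le

end Logistic

/-! ### The loss and its critical points -/

section Loss

variable {V : Type*} {w p : V → V → ℝ}

theorem weight_mul_sigmoid_sub_antisymm (hs : ∀ i j, w i j = w j i) (hp : ∀ i j, p i j + p j i = 1)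
    (θ : V → ℝ) (i j : V) : w i j * (Real.sigmoid (θ i - θ j) - p i j) =
      -(w j i * (Real.sigmoid (θ j - θ i) - p j i)) := by
  rw [hs j i, eq_sub_of_add_eq' (hp i j), ← neg_sub (θ i) (θ j), Real.sigmoid_neg]
  ring

variable [Fintype V]

/-- The negative log-likelihood with weights `w`, as a function of the empirical frequencies `p i j`
of a win of `i` over `j`; every pair occurs twice in the double sum, hence the factor `1 / 2`. -/
noncomputable def pairLoss (w p : V → V → ℝ) (θ : V → ℝ) : ℝ :=
  (∑ i, ∑ j, w i j * (softplus (θ i - θ j) - p i j * (θ i - θ j))) / 2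

/-- `θ` is a critical point of `pairLoss w p`: its gradient vanishes at `θ`. -/
def IsCritical (w p : V → V → ℝ) (θ : V → ℝ) : Prop :=
  ∀ i, ∑ j, w i j * (Real.sigmoid (θ i - θ j) - p i j) = 0

variable (hs : ∀ i j, w i j = w j i) (hp : ∀ i j, p i j + p j i = 1)
include hs hp

theorem IsCritical.pairLoss_sub_eq {θ : V → ℝ} (hθ : IsCritical w p θ) (θ' : V → ℝ) :
    pairLoss w p θ' - pairLoss w p θ = (∑ i, ∑ j, w i j * (softplus (θ' i - θ' j) -
      (softplus (θ i - θ j) + Real.sigmoid (θ i - θ j) * ((θ' i - θ' j) - (θ i - θ j))))) / 2 := by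
  have first_order : (∑ i, ∑ j, w i j * (Real.sigmoid (θ i - θ j) - p i j) *
      ((θ' - θ) i - (θ' - θ) j)) / 2 = 0 := by
    rw [← sum_mul_sum_of_antisymm (weight_mul_sigmoid_sub_antisymm hs hp θ)]
    exact Finset.sum_eq_zero fun i _ => by rw [hθ i, mul_zero]
  rw [← sub_zero (pairLoss w p θ' - pairLoss w p θ), ← first_order, pairLoss, pairLoss, ← sub_div,
    ← sub_div]
  simp_rw [← Finset.sum_sub_distrib, Pi.sub_apply]
  refine congrArg (· / 2) (Finset.sum_congr rfl fun i _ => Finset.sum_congr rfl fun j _ => ?_)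
  ring

variable (h0 : ∀ i j, 0 ≤ w i j)
include h0

theorem IsCritical.pairLoss_le {θ : V → ℝ} (hθ : IsCritical w p θ) (θ' : V → ℝ) :
    pairLoss w p θ ≤ pairLoss w p θ' := by
  rw [← sub_nonneg, hθ.pairLoss_sub_eq hs hp θ']
  exact div_nonneg (Finset.sum_nonneg fun i _ => Finset.sum_nonneg fun j _ => mul_nonneg (h0 i j)
    (sub_nonneg.2 (softplus_add_sigmoid_mul_le _ _))) two_pos.le

theorem IsCritical.sub_eq_sub_of_pairLoss_le {θ θ' : V → ℝ} (hθ : IsCritical w p θ)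
    (hle : pairLoss w p θ' ≤ pairLoss w p θ) {i j : V} (hw : w i j ≠ 0) :
    θ' i - θ i = θ' j - θ j := by
  have term_nonneg : ∀ i j, 0 ≤ w i j * (softplus (θ' i - θ' j) -
      (softplus (θ i - θ j) + Real.sigmoid (θ i - θ j) * ((θ' i - θ' j) - (θ i - θ j)))) :=
    fun i j => mul_nonneg (h0 i j) (sub_nonneg.2 (softplus_add_sigmoid_mul_le _ _))
  have sum_eq_zero := (sub_nonpos.2 hle).antisymm (sub_nonneg.2 (hθ.pairLoss_le hs hp h0 θ'))
  rw [hθ.pairLoss_sub_eq hs hp θ', div_eq_zero_iff, or_iff_left two_ne_zero,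
    Fintype.sum_eq_zero_iff_of_nonneg fun i => Finset.sum_nonneg fun j _ => term_nonneg i j]
    at sum_eq_zero
  have row_eq_zero := congrFun sum_eq_zero i
  rw [Pi.zero_apply, Finset.sum_eq_zero_iff_of_nonneg fun j _ => term_nonneg i j] at row_eq_zero
  have term_eq_zero := (mul_eq_zero.1 (row_eq_zero j (Finset.mem_univ j))).resolve_left hw
  by_contra hne
  exact (sub_pos.2 (softplus_add_sigmoid_mul_lt
    (x := θ i - θ j) (y := θ' i - θ' j) fun h => hne (by linarith))).ne' term_eq_zero

theorem IsCritical.eq_of_pairLoss_le {l : ℝ} (hl : 0 < l) (hw : HasGap w l) {θ θ' : V → ℝ}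
    (hθ : IsCritical w p θ) (hsum : ∑ i, θ' i = ∑ i, θ i)
    (hle : pairLoss w p θ' ≤ pairLoss w p θ) : θ' = θ := by
  refine sub_eq_zero.1 (hw.eq_zero_of_energy_le_zero hl ?_ ?_)
  · simp only [Pi.sub_apply, Finset.sum_sub_distrib, hsum, sub_self]
  · refine (div_eq_zero_iff.2 (Or.inl ?_)).le
    refine Finset.sum_eq_zero fun i _ => Finset.sum_eq_zero fun j _ => ?_
    by_cases hij : w i j = 0
    · rw [hij, zero_mul]
    · rw [Pi.sub_apply, Pi.sub_apply, hθ.sub_eq_sub_of_pairLoss_le hs hp h0 hle hij, sub_self,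
        zero_pow two_ne_zero, mul_zero]

end Loss

section Observations

variable {n L : ℕ}

theorem sum_sum_lt_eq_half {F : Fin n → Fin n → ℝ} (hF : ∀ i j, F i j = F j i)
    (hdiag : ∀ i, F i i = 0) :
    ∑ i, ∑ j ∈ Finset.univ.filter (fun j => j < i), F i j = (∑ i, ∑ j, F i j) / 2 := by
  have swap : ∑ i, ∑ j ∈ Finset.univ.filter (fun j => i < j), F i j =
      ∑ i, ∑ j ∈ Finset.univ.filter (fun j => j < i), F i j := by
    simp only [Finset.sum_filter]
    rw [Finset.sum_comm]
    simp only [hF]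
  have split (i : Fin n) : ∑ j, F i j = ∑ j ∈ Finset.univ.filter (fun j => j < i), F i j +
      ∑ j ∈ Finset.univ.filter (fun j => i < j), F i j := by
    rw [Finset.sum_filter, Finset.sum_filter, ← Finset.sum_add_distrib]
    refine Finset.sum_congr rfl fun j _ => ?_
    rcases lt_trichotomy j i with h | rfl | h
    · rw [if_pos h, if_neg h.asymm, add_zero]
    · simp only [lt_self_iff_false, if_false, hdiag, add_zero]
    · rw [if_neg h.asymm, if_pos h, zero_add]
  simp only [split, Finset.sum_add_distrib, swap]
  ring

/-- The empirical frequency of a win of `i` over `j`, where a pair is observed through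
`y (max i j) (min i j)`. The value `1 / 2` at `i = j` makes `winFreq y i j + winFreq y j i = 1` hold
without exception. -/
noncomputable def winFreq (y : Fin n → Fin n → Fin L → Bool) (i j : Fin n) : ℝ :=
  if j < i then (∑ l, winRev (y i j l)) / L
  else if i < j then 1 - (∑ l, winRev (y j i l)) / L else 1 / 2

theorem winFreq_of_lt (y : Fin n → Fin n → Fin L → Bool) {i j : Fin n} (h : j < i) :
    winFreq y i j = (∑ l, winRev (y i j l)) / L :=
  if_pos h

theorem winFreq_add_swap (y : Fin n → Fin n → Fin L → Bool) (i j : Fin n) :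
    winFreq y i j + winFreq y j i = 1 := by
  rcases lt_trichotomy i j with h | rfl | h
  · simp only [winFreq, h, h.asymm, if_true, if_false, sub_add_cancel]
  · simp only [winFreq, lt_self_iff_false, if_false, add_halves]
  · simp only [winFreq, h, h.asymm, if_true, if_false, add_sub_cancel]

theorem neg_log_likelihood (b : Bool) (s t : ℝ) :
    -Real.log (winRev b * (Real.exp s / (Real.exp s + Real.exp t)) +
      (1 - winRev b) * (Real.exp t / (Real.exp s + Real.exp t))) =
      softplus (s - t) - winRev b * (s - t) := by
  have log_add : Real.log (Real.exp s + Real.exp t) = t + softplus (s - t) := by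
    rw [softplus, ← Real.log_exp t, ← Real.log_mul (Real.exp_pos _).ne' (by positivity), mul_add,
      ← Real.exp_add, Real.log_exp, add_sub_cancel, mul_one, add_comm]
  have log_div (r : ℝ) : Real.log (Real.exp r / (Real.exp s + Real.exp t)) =
      r - (t + softplus (s - t)) := by
    rw [Real.log_div (Real.exp_pos _).ne' (by positivity), Real.log_exp, log_add]
  cases b
  · simp only [winRev, Bool.false_eq_true, if_false, one_mul, sub_self, zero_mul, add_zero, log_div]
    ring
  · simp only [winRev, if_true, zero_mul, sub_zero, one_mul, zero_add, log_div]
    ring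

theorem wLoss_eq_pairLoss (hL : 0 < L) {w : Fin n → Fin n → ℝ} (hs : ∀ i j, w i j = w j i)
    (h0 : ∀ i, w i i = 0) (y : Fin n → Fin n → Fin L → Bool) (θ : Fin n → ℝ) :
    wLoss w y θ = pairLoss w (winFreq y) θ := by
  have pair_symm (i j : Fin n) : w i j * (softplus (θ i - θ j) - winFreq y i j * (θ i - θ j)) =
      w j i * (softplus (θ j - θ i) - winFreq y j i * (θ j - θ i)) := by
    rw [hs j i, eq_sub_of_add_eq (winFreq_add_swap y j i), ← neg_sub (θ i) (θ j)]
    linear_combination w i j * softplus_sub_softplus_neg (θ i - θ j)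
  rw [wLoss, pairLoss, ← sum_sum_lt_eq_half pair_symm fun i => by rw [h0, zero_mul],
    neg_mul, ← mul_neg, ← Finset.sum_neg_distrib, Finset.mul_sum]
  refine Finset.sum_congr rfl fun i _ => ?_
  rw [← Finset.sum_neg_distrib, Finset.mul_sum]
  refine Finset.sum_congr rfl fun j hj => ?_
  have hL' : (L : ℝ) ≠ 0 := by positivity
  simp_rw [← Finset.sum_neg_distrib, ← mul_neg, neg_log_likelihood]
  rw [winFreq_of_lt y (Finset.mem_filter.1 hj).2, ← Finset.mul_sum, Finset.sum_sub_distrib,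
    ← Finset.sum_mul, Finset.sum_const, Finset.card_univ, Fintype.card_fin, nsmul_eq_mul]
  field_simp

theorem isWeightedMLE_iff_eq (hL : 0 < L) {w : Fin n → Fin n → ℝ} (hs : ∀ i j, w i j = w j i)
    (h0 : ∀ i j, 0 ≤ w i j) (hdiag : ∀ i, w i i = 0) {l : ℝ} (hl : 0 < l) (hw : HasGap w l)
    {y : Fin n → Fin n → Fin L → Bool} {θ : Fin n → ℝ} (hθ : IsCritical w (winFreq y) θ)
    (hsum : ∑ i, θ i = 0) (θ' : Fin n → ℝ) : IsWeightedMLE w y θ' ↔ θ' = θ := by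
  rw [IsWeightedMLE, funext (wLoss_eq_pairLoss hL hs hdiag y)]
  constructor
  · rintro ⟨hsum', hmin⟩
    exact hθ.eq_of_pairLoss_le hs (winFreq_add_swap y) h0 hl hw (hsum'.trans hsum.symm) (hmin hsum)
  · rintro rfl
    exact ⟨hsum, fun θ _ => hθ.pairLoss_le hs (winFreq_add_swap y) h0 θ⟩

end Observations

/-! ### A critical point near the Newton step -/

theorem exists_fixedPoint_of_norm_sub_le {E : Type*} [NormedAddCommGroup E] [CompleteSpace E]
    {T : E → E} {Q : ℝ} (hQ : 0 ≤ Q) (h0 : ‖T 0‖ ≤ Q / 2)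
    (hT : ∀ h h', ‖h‖ ≤ Q → ‖h'‖ ≤ Q → ‖T h - T h'‖ ≤ 1 / 2 * ‖h - h'‖) :
    ∃ h, ‖h‖ ≤ Q ∧ T h = h := by
  have mapsTo : Set.MapsTo T (Metric.closedBall 0 Q) (Metric.closedBall 0 Q) := fun h hh => by
    rw [mem_closedBall_zero_iff] at hh ⊢
    have dist_le := hT h 0 hh (by rwa [norm_zero])
    rw [sub_zero] at dist_le
    linarith [norm_le_norm_sub_add (T h) (T 0)]
  have contracting : ContractingWith (1 / 2) (mapsTo.restrict T _ _) := by
    refine ⟨by norm_num, LipschitzWith.of_dist_le_mul fun a b => ?_⟩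
    have norm_sub_le := hT a b (mem_closedBall_zero_iff.1 a.2) (mem_closedBall_zero_iff.1 b.2)
    simpa [Subtype.dist_eq, dist_eq_norm] using norm_sub_le
  obtain ⟨h, hh, hfix, -⟩ := contracting.exists_fixedPoint' Metric.isClosed_closedBall.isComplete
    mapsTo (x := 0) (Metric.mem_closedBall_self hQ) (edist_ne_top _ _)
  exact ⟨h, mem_closedBall_zero_iff.1 hh, hfix⟩

section Newton

variable {V : Type*}

/-- The weights whose Laplacian is the Hessian of `pairLoss w p` at `θ`. -/
noncomputable def hessWeight (w : V → V → ℝ) (θ : V → ℝ) (i j : V) : ℝ :=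
  w i j * sigmoidDeriv (θ i - θ j)

theorem hessWeight_symm {w : V → V → ℝ} (hs : ∀ i j, w i j = w j i) (θ : V → ℝ) (i j : V) :
    hessWeight w θ i j = hessWeight w θ j i := by
  rw [hessWeight, hessWeight, hs, ← sigmoidDeriv_neg, neg_sub]

variable [Fintype V]

/-- The negative gradient of `pairLoss w p` at `θ`. -/
noncomputable def score (w p : V → V → ℝ) (θ : V → ℝ) (i : V) : ℝ :=
  ∑ j, w i j * (p i j - Real.sigmoid (θ i - θ j))

theorem isCritical_iff_score_eq_zero {w p : V → V → ℝ} {θ : V → ℝ} :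
    IsCritical w p θ ↔ score w p θ = 0 := by
  have score_eq (i : V) :
      score w p θ i = -∑ j, w i j * (Real.sigmoid (θ i - θ j) - p i j) := by
    simp only [score, ← Finset.sum_neg_distrib, ← mul_neg, neg_sub]
  simp only [IsCritical, funext_iff, score_eq, Pi.zero_apply, neg_eq_zero]

variable [DecidableEq V]

/-- The step of Newton's method for `pairLoss w p` at `θ`. -/
noncomputable def newtonStep (w p : V → V → ℝ) (θ : V → ℝ) : V → ℝ :=
  poisson (hessWeight w θ) (score w p θ)

/-- What must be added to the Newton step at `θ` in order that `θ + u` be a critical point: the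
Newton step for the terms of the gradient at `θ + u` that are of second order in `u`. -/
noncomputable def correction (w : V → V → ℝ) (θ u : V → ℝ) : V → ℝ :=
  poisson (hessWeight w θ) fun i => ∑ j, -(w i j * sigmoidRemainder (θ i - θ j) (u i - u j))

/-- The total absolute flow through the vertex `i`, for edge conductances `w`, of the Green function
of `z` with pole `k`. -/
noncomputable def greenFlow (w z : V → V → ℝ) (k i : V) : ℝ :=
  ∑ j, w i j * |green z k i - green z k j|

section GreenFlow

theorem greenFlow_nonneg {w : V → V → ℝ} (h0 : ∀ i j, 0 ≤ w i j) (z : V → V → ℝ) (k i : V) :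
    0 ≤ greenFlow w z k i :=
  Finset.sum_nonneg fun j _ => mul_nonneg (h0 i j) (abs_nonneg _)

variable {w : V → V → ℝ} (hs : ∀ i j, w i j = w j i) (h0 : ∀ i j, 0 ≤ w i j)
include hs h0

theorem sum_sum_mul_abs_green_mul_sq_le (z : V → V → ℝ) (u : V → ℝ) (k : V) :
    ∑ i, ∑ j, w i j * |green z k i - green z k j| * (u i - u j) ^ 2 ≤
      4 * ∑ i, greenFlow w z k i * u i ^ 2 := by
  have flow_symm (i j : V) : w i j * |green z k i - green z k j| =
      w j i * |green z k j - green z k i| := by rw [hs, abs_sub_comm]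
  calc ∑ i, ∑ j, w i j * |green z k i - green z k j| * (u i - u j) ^ 2
      ≤ ∑ i, ∑ j, 2 * (w i j * |green z k i - green z k j| * (u i ^ 2 + u j ^ 2)) := by
        refine Finset.sum_le_sum fun i _ => Finset.sum_le_sum fun j _ => ?_
        rw [mul_left_comm]
        exact mul_le_mul_of_nonneg_left (by linarith [sq_nonneg (u i + u j)])
          (mul_nonneg (h0 i j) (abs_nonneg _))
    _ = 4 * ∑ i, greenFlow w z k i * u i ^ 2 := by
        simp only [← Finset.mul_sum, sum_sum_mul_add_of_symm flow_symm fun i => u i ^ 2, greenFlow]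
        ring

theorem sq_sum_sum_mul_abs_green_mul_abs_le (z : V → V → ℝ) (u : V → ℝ) (k : V) :
    (∑ i, ∑ j, w i j * |green z k i - green z k j| * |u i - u j|) ^ 2 ≤
      (∑ i, greenFlow w z k i) * (4 * ∑ i, greenFlow w z k i * u i ^ 2) := by
  have flow_nonneg (i j : V) : 0 ≤ w i j * |green z k i - green z k j| :=
    mul_nonneg (h0 i j) (abs_nonneg _)
  have cauchy_schwarz : (∑ i, ∑ j, w i j * |green z k i - green z k j| * |u i - u j|) ^ 2 ≤
      (∑ i, greenFlow w z k i) *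
        ∑ i, ∑ j, w i j * |green z k i - green z k j| * (u i - u j) ^ 2 := by
    simp only [greenFlow, ← Fintype.sum_prod_type']
    refine Finset.sum_sq_le_sum_mul_sum_of_sq_le_mul _ (fun q _ => flow_nonneg q.1 q.2)
      (fun q _ => mul_nonneg (flow_nonneg q.1 q.2) (sq_nonneg _)) (fun q _ => le_of_eq ?_)
    rw [mul_pow _ |u q.1 - u q.2|, sq_abs]
    ring
  refine cauchy_schwarz.trans (mul_le_mul_of_nonneg_left
    (sum_sum_mul_abs_green_mul_sq_le hs h0 z u k) ?_)
  exact Finset.sum_nonneg fun i _ => greenFlow_nonneg h0 z k i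

end GreenFlow

section Poisson

variable [Nonempty V] {z F : V → V → ℝ} {l : ℝ}
variable (hs : ∀ i j, z i j = z j i) (hl : 0 < l) (hz : HasGap z l) (hF : ∀ i j, F i j = -F j i)
include hs hl hz hF

theorem poisson_sum_of_antisymm (k : V) : poisson z (fun i => ∑ j, F i j) k =
    (∑ i, ∑ j, F i j * (green z k i - green z k j)) / 2 := by
  rw [← sum_mul_sum_of_antisymm hF, poisson_eq_sum_green hs hl hz]
  simp only [mul_comm]

theorem abs_poisson_sum_le (k : V) : |poisson z (fun i => ∑ j, F i j) k| ≤
    (∑ i, ∑ j, |F i j| * |green z k i - green z k j|) / 2 := by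
  rw [poisson_sum_of_antisymm hs hl hz hF, abs_div, abs_two]
  gcongr
  refine (Finset.abs_sum_le_sum_abs _ _).trans (Finset.sum_le_sum fun i _ => ?_)
  simpa only [abs_mul] using Finset.abs_sum_le_sum_abs
    (fun j => F i j * (green z k i - green z k j)) Finset.univ

theorem lap_poisson_sum_of_antisymm (i : V) :
    lap z (poisson z fun i => ∑ j, F i j) i = ∑ j, F i j := by
  rw [lap_poisson hs hl hz, sum_sum_eq_zero_of_antisymm hF, zero_div, sub_zero]

end Poisson

variable [Nonempty V] {w p : V → V → ℝ} {θ : V → ℝ} {l : ℝ}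
variable (hs : ∀ i j, w i j = w j i) (hl : 0 < l) (hz : HasGap (hessWeight w θ) l)
include hs

omit [Fintype V] [DecidableEq V] [Nonempty V] in
theorem mul_sigmoidRemainder_antisymm (u : V → ℝ) (i j : V) :
    -(w i j * sigmoidRemainder (θ i - θ j) (u i - u j)) =
      -(-(w j i * sigmoidRemainder (θ j - θ i) (u j - u i))) := by
  rw [hs, ← neg_sub (θ j), ← neg_sub (u j), sigmoidRemainder_neg]
  ring

include hl hz

theorem isCritical_add_of_sub_newtonStep_eq (hp : ∀ i j, p i j + p j i = 1) {u : V → ℝ}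
    (hu : u - newtonStep w p θ = correction w θ u) : IsCritical w p (θ + u) := by
  intro i
  have score_antisymm (i j : V) : w i j * (p i j - Real.sigmoid (θ i - θ j)) =
      -(w j i * (p j i - Real.sigmoid (θ j - θ i))) := by
    linear_combination -weight_mul_sigmoid_sub_antisymm hs hp θ i j
  have lap_newtonStep : lap (hessWeight w θ) (newtonStep w p θ) i = score w p θ i :=
    lap_poisson_sum_of_antisymm (hessWeight_symm hs θ) hl hz score_antisymm i
  have lap_correction : lap (hessWeight w θ) (correction w θ u) i =
      ∑ j, -(w i j * sigmoidRemainder (θ i - θ j) (u i - u j)) :=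
    lap_poisson_sum_of_antisymm (hessWeight_symm hs θ) hl hz (mul_sigmoidRemainder_antisymm hs u) i
  rw [← hu, lap_sub, lap_newtonStep, lap, score, ← sub_eq_zero, ← Finset.sum_sub_distrib,
    ← Finset.sum_sub_distrib] at lap_correction
  rw [← lap_correction]
  refine Finset.sum_congr rfl fun j _ => ?_
  rw [hessWeight, sigmoidRemainder, Pi.add_apply, Pi.add_apply, add_sub_add_comm]
  ring

variable (h0 : ∀ i j, 0 ≤ w i j)
include h0

theorem abs_correction_le (u : V → ℝ) (k : V) :
    |correction w θ u k| ≤ (∑ i, greenFlow w (hessWeight w θ) k i * u i ^ 2) / 2 := by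
  calc |correction w θ u k|
      ≤ (∑ i, ∑ j, |-(w i j * sigmoidRemainder (θ i - θ j) (u i - u j))| *
          |green (hessWeight w θ) k i - green (hessWeight w θ) k j|) / 2 :=
        abs_poisson_sum_le (hessWeight_symm hs θ) hl hz (mul_sigmoidRemainder_antisymm hs u) k
    _ ≤ (∑ i, ∑ j, 1 / 4 * (w i j * |green (hessWeight w θ) k i - green (hessWeight w θ) k j| *
          (u i - u j) ^ 2)) / 2 := by
        refine div_le_div_of_nonneg_right
          (Finset.sum_le_sum fun i _ => Finset.sum_le_sum fun j _ => ?_) two_pos.le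
        rw [abs_neg, abs_mul, abs_of_nonneg (h0 i j), mul_right_comm, mul_left_comm]
        exact mul_le_mul_of_nonneg_left (abs_sigmoidRemainder_le _ _)
          (mul_nonneg (h0 i j) (abs_nonneg _))
    _ ≤ (∑ i, greenFlow w (hessWeight w θ) k i * u i ^ 2) / 2 := by
        simp only [← Finset.mul_sum]
        linarith [sum_sum_mul_abs_green_mul_sq_le hs h0 (hessWeight w θ) u k]

theorem abs_correction_sub_le (u u' : V → ℝ) (k : V) :
    |correction w θ u k - correction w θ u' k| ≤
      (∑ i, ∑ j, w i j * |green (hessWeight w θ) k i - green (hessWeight w θ) k j| *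
        (|u i - u j| + |u' i - u' j|)) / 4 * ‖u - u'‖ := by
  have grad_le (i j : V) : |(u i - u j) - (u' i - u' j)| ≤ 2 * ‖u - u'‖ := by
    rw [sub_sub_sub_comm, two_mul]
    exact (abs_sub _ _).trans
      (add_le_add (norm_le_pi_norm (u - u') i) (norm_le_pi_norm (u - u') j))
  have sub_antisymm (i j : V) := congrArg₂ (· - ·)
    (mul_sigmoidRemainder_antisymm (θ := θ) hs u i j)
    (mul_sigmoidRemainder_antisymm (θ := θ) hs u' i j)
  have sub_eq : correction w θ u k - correction w θ u' k = poisson (hessWeight w θ) (fun i =>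
      ∑ j, (-(w i j * sigmoidRemainder (θ i - θ j) (u i - u j)) -
        -(w i j * sigmoidRemainder (θ i - θ j) (u' i - u' j)))) k := by
    simp only [correction, poisson_eq_sum_green (hessWeight_symm hs θ) hl hz,
      ← Finset.sum_sub_distrib, ← sub_mul]
  have term_le (i j : V) : |-(w i j * sigmoidRemainder (θ i - θ j) (u i - u j)) -
      -(w i j * sigmoidRemainder (θ i - θ j) (u' i - u' j))| *
        |green (hessWeight w θ) k i - green (hessWeight w θ) k j| ≤
      w i j * |green (hessWeight w θ) k i - green (hessWeight w θ) k j| *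
        (|u i - u j| + |u' i - u' j|) * (‖u - u'‖ / 2) := by
    have remainder_le := (abs_sigmoidRemainder_sub_le (θ i - θ j) (u i - u j) (u' i - u' j)).trans
      (mul_le_mul_of_nonneg_left (grad_le i j) (by positivity))
    rw [neg_sub_neg, ← mul_sub, abs_mul, abs_of_nonneg (h0 i j), abs_sub_comm, mul_right_comm]
    refine (mul_le_mul_of_nonneg_left remainder_le
      (mul_nonneg (h0 i j) (abs_nonneg _))).trans_eq ?_
    ring
  rw [sub_eq]
  refine (abs_poisson_sum_le (hessWeight_symm hs θ) hl hz
    (fun i j => (sub_antisymm i j).trans (by ring)) k).trans ?_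
  refine (div_le_div_of_nonneg_right (Finset.sum_le_sum fun i _ => Finset.sum_le_sum fun j _ =>
    term_le i j) two_pos.le).trans_eq ?_
  simp only [← Finset.sum_mul]
  ring

variable {S Q : ℝ} (hS : ∀ k, ∑ i, greenFlow w (hessWeight w θ) k i ≤ 2 * S)
variable (hQ : ∀ k, ∑ i, greenFlow w (hessWeight w θ) k i * newtonStep w p θ i ^ 2 ≤ Q)
variable (hQ0 : 0 ≤ Q) (hSQ : S * Q ≤ 1 / 50)
include hS hQ hQ0 hSQ

theorem norm_correction_add_sub_le {h h' : V → ℝ} (hh : ‖h‖ ≤ Q) (hh' : ‖h'‖ ≤ Q) :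
    ‖correction w θ (newtonStep w p θ + h) - correction w θ (newtonStep w p θ + h')‖ ≤
      1 / 2 * ‖h - h'‖ := by
  set g := newtonStep w p θ
  set flow := fun k i j => w i j * |green (hessWeight w θ) k i - green (hessWeight w θ) k j|
  have flow_nonneg (k i j : V) : 0 ≤ flow k i j := mul_nonneg (h0 i j) (abs_nonneg _)
  have sum_flow_le (k : V) : ∑ i, ∑ j, flow k i j ≤ 2 * S := hS k
  have sum_flow_mul_le (k : V) : ∑ i, ∑ j, flow k i j * |g i - g j| ≤ 2 / 5 := by
    refine le_of_abs_le (abs_le_of_sq_le_sq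
      ((sq_sum_sum_mul_abs_green_mul_abs_le hs h0 (hessWeight w θ) g k).trans ?_) (by norm_num))
    have flow_mul_sq_nonneg : 0 ≤ ∑ i, greenFlow w (hessWeight w θ) k i * g i ^ 2 :=
      Finset.sum_nonneg fun i _ => mul_nonneg (greenFlow_nonneg h0 _ k i) (sq_nonneg _)
    calc (∑ i, greenFlow w (hessWeight w θ) k i) *
          (4 * ∑ i, greenFlow w (hessWeight w θ) k i * g i ^ 2)
        ≤ 2 * S * (4 * Q) := mul_le_mul (hS k) (by linarith [hQ k]) (by positivity)
          ((Finset.sum_nonneg fun i _ => greenFlow_nonneg h0 _ k i).trans (hS k))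
      _ ≤ (2 / 5) ^ 2 := by linarith
  have grad_le {f : V → ℝ} (hf : ‖f‖ ≤ Q) (i j : V) :
      |(g + f) i - (g + f) j| ≤ |g i - g j| + 2 * Q := by
    rw [Pi.add_apply, Pi.add_apply, add_sub_add_comm]
    refine (abs_add_le _ _).trans (add_le_add_right ((abs_sub _ _).trans ?_) _)
    linarith [(norm_le_pi_norm f i).trans hf, (norm_le_pi_norm f j).trans hf,
      Real.norm_eq_abs (f i), Real.norm_eq_abs (f j)]
  refine (pi_norm_le_iff_of_nonneg (by positivity)).2 fun k => ?_
  refine (abs_correction_sub_le hs hl hz h0 (g + h) (g + h') k).trans ?_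
  rw [add_sub_add_left_eq_sub]
  refine mul_le_mul_of_nonneg_right ?_ (norm_nonneg _)
  calc (∑ i, ∑ j, flow k i j * (|(g + h) i - (g + h) j| + |(g + h') i - (g + h') j|)) / 4
      ≤ (∑ i, ∑ j, flow k i j * ((|g i - g j| + 2 * Q) + (|g i - g j| + 2 * Q))) / 4 := by
        gcongr with i _ j _
        · exact flow_nonneg k i j
        · exact grad_le hh i j
        · exact grad_le hh' i j
    _ = (∑ i, ∑ j, flow k i j * |g i - g j|) / 2 + (∑ i, ∑ j, flow k i j) * Q := by
        simp only [mul_add, Finset.sum_add_distrib, ← Finset.sum_mul]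
        ring
    _ ≤ 1 / 2 := by linarith [sum_flow_mul_le k, mul_le_mul_of_nonneg_right (sum_flow_le k) hQ0]

theorem exists_isCritical (hp : ∀ i j, p i j + p j i = 1) :
    ∃ θ' : V → ℝ, ∑ i, θ' i = ∑ i, θ i ∧ IsCritical w p θ' ∧
      ∀ k, |θ' k - θ k| ≤ |newtonStep w p θ k| + Q := by
  obtain ⟨h, hh, hfix⟩ := exists_fixedPoint_of_norm_sub_le
    (T := fun h => correction w θ (newtonStep w p θ + h)) hQ0
    ((pi_norm_le_iff_of_nonneg (by positivity)).2 fun k => by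
      rw [add_zero]
      exact (abs_correction_le hs hl hz h0 _ k).trans (by linarith [hQ k]))
    fun h h' => norm_correction_add_sub_le hs hl hz h0 hS hQ hQ0 hSQ
  have sum_newtonStep : ∑ i, newtonStep w p θ i = 0 := sum_poisson (hessWeight_symm hs θ) hl hz _
  have sum_h : ∑ i, h i = 0 := by
    rw [← hfix]
    exact sum_poisson (hessWeight_symm hs θ) hl hz _
  refine ⟨θ + (newtonStep w p θ + h), ?_, isCritical_add_of_sub_newtonStep_eq hs hl hz hp ?_,
    fun k => ?_⟩
  · simp only [Pi.add_apply, Finset.sum_add_distrib, sum_newtonStep, sum_h, add_zero]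
  · rw [add_sub_cancel_left]
    exact hfix.symm
  · rw [Pi.add_apply, add_sub_cancel_left]
    exact (abs_add_le _ _).trans (add_le_add_right ((norm_le_pi_norm h k).trans hh) _)

end Newton

/-! ### The spectral gap of the weighted Laplacian -/

section AlgebraicConnectivity

variable {V : Type*} [Fintype V]

theorem HasGap.mono {z : V → V → ℝ} {l l' : ℝ} (hz : HasGap z l) (h : l' ≤ l) : HasGap z l' :=
  fun v hv => (mul_le_mul_of_nonneg_right h (Finset.sum_nonneg fun _ _ => sq_nonneg _)).trans
    (hz v hv)

theorem HasGap.le_of_energy_le {z : V → V → ℝ} {l m : ℝ} (hz : HasGap z l) {v : V → ℝ}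
    (hv : ∑ i, v i = 0) (hpos : 0 < ∑ i, v i ^ 2) (hle : energy z v ≤ m * ∑ i, v i ^ 2) : l ≤ m :=
  le_of_mul_le_mul_right ((hz v hv).trans hle) hpos

theorem isClosed_setOf_hasGap : IsClosed {q : (V → V → ℝ) × ℝ | HasGap q.1 q.2} := by
  simp only [HasGap, Set.ofPred_forall, energy]
  exact isClosed_iInter fun v => isClosed_iInter fun _ =>
    isClosed_le (by fun_prop) (by fun_prop)

theorem exists_hasGap (z : V → V → ℝ) : ∃ l, HasGap z l := by
  refine ⟨-(2 * ∑ i, ∑ j, |z i j|), fun v _ => ?_⟩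
  have sq_le (i : V) : v i ^ 2 ≤ ∑ k, v k ^ 2 :=
    Finset.single_le_sum (f := fun k => v k ^ 2) (fun _ _ => sq_nonneg _) (Finset.mem_univ i)
  calc -(2 * ∑ i, ∑ j, |z i j|) * ∑ k, v k ^ 2
      = (∑ i, ∑ j, -(|z i j| * (4 * ∑ k, v k ^ 2))) / 2 := by
        simp only [Finset.sum_neg_distrib, ← Finset.sum_mul]
        ring
    _ ≤ energy z v := by
        refine div_le_div_of_nonneg_right
          (Finset.sum_le_sum fun i _ => Finset.sum_le_sum fun j _ => ?_) two_pos.le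
        refine (neg_le_neg (mul_le_mul_of_nonneg_left (b := (v i - v j) ^ 2) ?_
          (abs_nonneg _))).trans ?_
        · linarith [sq_le i, sq_le j, sq_nonneg (v i + v j)]
        · rw [← neg_mul]
          exact mul_le_mul_of_nonneg_right (neg_abs_le _) (sq_nonneg _)

/-- The second smallest eigenvalue of the Laplacian of `z`, through its variational
characterization; unlike `spectralGap`, it makes sense for all weights and is visibly measurable. -/
noncomputable def algebraicConnectivity (z : V → V → ℝ) : ℝ := sSup {l | HasGap z l}

variable [Nontrivial V]

theorem bddAbove_setOf_hasGap (z : V → V → ℝ) : BddAbove {l | HasGap z l} := by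
  classical
  obtain ⟨a, b, hab⟩ := exists_pair_ne V
  set v : V → ℝ := Pi.single a 1 - Pi.single b 1
  have sum_eq_zero : ∑ i, v i = 0 := by simp [v]
  have sum_sq_pos : 0 < ∑ i, v i ^ 2 :=
    Finset.sum_pos' (fun i _ => sq_nonneg _) ⟨a, Finset.mem_univ a, by simp [v, hab]⟩
  exact ⟨energy z v / ∑ i, v i ^ 2, fun l hl =>
    hl.le_of_energy_le sum_eq_zero sum_sq_pos (div_mul_cancel₀ _ sum_sq_pos.ne').ge⟩

theorem le_algebraicConnectivity_iff {z : V → V → ℝ} {l : ℝ} :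
    l ≤ algebraicConnectivity z ↔ HasGap z l := by
  refine ⟨fun h => HasGap.mono ?_ h, fun h => le_csSup (bddAbove_setOf_hasGap z) h⟩
  exact (isClosed_setOf_hasGap.preimage (Continuous.prodMk_right z)).csSup_mem (exists_hasGap z)
    (bddAbove_setOf_hasGap z)

theorem measurable_algebraicConnectivity :
    Measurable (algebraicConnectivity : (V → V → ℝ) → ℝ) := by
  refine measurable_of_Ici fun l => ?_
  have preimage_eq : algebraicConnectivity ⁻¹' Set.Ici l = {z : V → V → ℝ | HasGap z l} :=
    Set.ext fun z => le_algebraicConnectivity_iff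
  rw [preimage_eq]
  exact (isClosed_setOf_hasGap.preimage (Continuous.prodMk_left l)).measurableSet

end AlgebraicConnectivity

section Hermitian

open scoped Matrix

variable {ι : Type*} [Fintype ι] [DecidableEq ι] {A : Matrix ι ι ℝ} (hA : A.IsHermitian)
include hA

theorem eigenvectorBasis_dotProduct (i : ι) (v : ι → ℝ) :
    hA.eigenvectorBasis i ⬝ᵥ v = inner ℝ (hA.eigenvectorBasis i) (WithLp.toLp 2 v) := by
  rw [EuclideanSpace.inner_eq_star_dotProduct, star_trivial, dotProduct_comm]

theorem eq_sum_eigenvectorBasis (v : ι → ℝ) :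
    v = ∑ i, (hA.eigenvectorBasis i ⬝ᵥ v) • (hA.eigenvectorBasis i : ι → ℝ) := by
  simpa only [WithLp.ofLp_sum, WithLp.ofLp_smul, ← eigenvectorBasis_dotProduct] using
    congrArg WithLp.ofLp (hA.eigenvectorBasis.sum_repr' (WithLp.toLp 2 v)).symm

theorem sum_sq_eq_sum_eigenvectorBasis (v : ι → ℝ) :
    ∑ i, v i ^ 2 = ∑ i, (hA.eigenvectorBasis i ⬝ᵥ v) ^ 2 := by
  simpa only [EuclideanSpace.real_norm_sq_eq, ← eigenvectorBasis_dotProduct, Real.norm_eq_abs,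
    sq_abs] using (hA.eigenvectorBasis.sum_sq_norm_inner_right (WithLp.toLp 2 v)).symm

theorem dotProduct_mulVec_eq_sum_eigenvalues (v : ι → ℝ) :
    v ⬝ᵥ (A *ᵥ v) = ∑ i, hA.eigenvalues i * (hA.eigenvectorBasis i ⬝ᵥ v) ^ 2 := by
  nth_rewrite 2 [eq_sum_eigenvectorBasis hA v]
  rw [Matrix.mulVec_sum, dotProduct_sum]
  refine Finset.sum_congr rfl fun i _ => ?_
  rw [Matrix.mulVec_smul, hA.mulVec_eigenvectorBasis, dotProduct_smul, dotProduct_smul,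
    dotProduct_comm, smul_eq_mul, smul_eq_mul]
  ring

theorem mul_sum_sq_le_dotProduct_mulVec {b : ι} {m : ℝ} (hm : ∀ i ≠ b, m ≤ hA.eigenvalues i)
    {v : ι → ℝ} (hv : hA.eigenvectorBasis b ⬝ᵥ v = 0) : m * ∑ i, v i ^ 2 ≤ v ⬝ᵥ (A *ᵥ v) := by
  rw [sum_sq_eq_sum_eigenvectorBasis hA, dotProduct_mulVec_eq_sum_eigenvalues hA, Finset.mul_sum]
  refine Finset.sum_le_sum fun i _ => ?_
  rcases eq_or_ne i b with rfl | hi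
  · rw [hv, zero_pow two_ne_zero, mul_zero, mul_zero]
  · exact mul_le_mul_of_nonneg_right (hm i hi) (sq_nonneg _)

theorem dotProduct_mulVec_le_mul_sum_sq {m : ℝ} {v : ι → ℝ}
    (hv : ∀ i, hA.eigenvectorBasis i ⬝ᵥ v ≠ 0 → hA.eigenvalues i ≤ m) :
    v ⬝ᵥ (A *ᵥ v) ≤ m * ∑ i, v i ^ 2 := by
  rw [sum_sq_eq_sum_eigenvectorBasis hA, dotProduct_mulVec_eq_sum_eigenvalues hA, Finset.mul_sum]
  refine Finset.sum_le_sum fun i _ => ?_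
  by_cases hi : hA.eigenvectorBasis i ⬝ᵥ v = 0
  · rw [hi, zero_pow two_ne_zero, mul_zero, mul_zero]
  · exact mul_le_mul_of_nonneg_right (hv i hi) (sq_nonneg _)

theorem eigenvectorBasis_dotProduct_eigenvectorBasis (i j : ι) :
    hA.eigenvectorBasis i ⬝ᵥ (hA.eigenvectorBasis j : ι → ℝ) = if i = j then 1 else 0 := by
  rw [eigenvectorBasis_dotProduct]
  exact orthonormal_iff_ite.1 hA.eigenvectorBasis.orthonormal i j

theorem exists_dotProduct_eq_zero_and_dotProduct_mulVec_le {a b : ι} (hab : a ≠ b) {m : ℝ}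
    (ha : hA.eigenvalues a ≤ m) (hb : hA.eigenvalues b ≤ m) (f : ι → ℝ) :
    ∃ v : ι → ℝ, f ⬝ᵥ v = 0 ∧ 0 < ∑ i, v i ^ 2 ∧ v ⬝ᵥ (A *ᵥ v) ≤ m * ∑ i, v i ^ 2 := by
  obtain ⟨x, y, hxy, hne⟩ : ∃ x y : ℝ, x * (f ⬝ᵥ (hA.eigenvectorBasis a : ι → ℝ)) +
      y * (f ⬝ᵥ (hA.eigenvectorBasis b : ι → ℝ)) = 0 ∧ (x ≠ 0 ∨ y ≠ 0) := by
    by_cases h : f ⬝ᵥ (hA.eigenvectorBasis a : ι → ℝ) = 0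
    · exact ⟨1, 0, by rw [h]; ring, Or.inl one_ne_zero⟩
    · exact ⟨-(f ⬝ᵥ (hA.eigenvectorBasis b : ι → ℝ)), _, by ring, Or.inr h⟩
  set v : ι → ℝ := x • (hA.eigenvectorBasis a : ι → ℝ) + y • (hA.eigenvectorBasis b : ι → ℝ)
  have coord (i : ι) : hA.eigenvectorBasis i ⬝ᵥ v =
      (if i = a then x else 0) + (if i = b then y else 0) := by
    simp only [v, dotProduct_add, dotProduct_smul, eigenvectorBasis_dotProduct_eigenvectorBasis,
      smul_eq_mul, mul_ite, mul_one, mul_zero]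
  refine ⟨v, ?_, ?_, dotProduct_mulVec_le_mul_sum_sq hA fun i hi => ?_⟩
  · rwa [dotProduct_add, dotProduct_smul, dotProduct_smul, smul_eq_mul, smul_eq_mul]
  · rw [sum_sq_eq_sum_eigenvectorBasis hA]
    rcases hne with h | h
    · exact Finset.sum_pos' (fun i _ => sq_nonneg _)
        ⟨a, Finset.mem_univ a, by rw [coord, if_pos rfl, if_neg hab, add_zero]; positivity⟩
    · exact Finset.sum_pos' (fun i _ => sq_nonneg _)
        ⟨b, Finset.mem_univ b, by rw [coord, if_pos rfl, if_neg hab.symm, zero_add]; positivity⟩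
  · by_contra hm
    refine hi ?_
    rw [coord, if_neg (by rintro rfl; exact hm ha), if_neg (by rintro rfl; exact hm hb), add_zero]

end Hermitian

section SpectralGap

open scoped Matrix

variable {n : ℕ}

theorem dotProduct_wLaplacian_mulVec_self {w : Fin n → Fin n → ℝ} (hs : ∀ i j, w i j = w j i)
    (v : Fin n → ℝ) : v ⬝ᵥ (wLaplacian w *ᵥ v) = energy w v := by
  rw [energy, ← sum_sum_lt_eq_half (fun i j => by rw [hs, ← neg_sub, neg_sq]) (fun i => by simp),
    wLaplacian, Matrix.sum_mulVec, dotProduct_sum]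
  refine Finset.sum_congr rfl fun i _ => ?_
  rw [Matrix.sum_mulVec, dotProduct_sum]
  refine Finset.sum_congr rfl fun j _ => ?_
  have edgeVec_dotProduct : edgeVec i j ⬝ᵥ v = v i - v j := by simp [edgeVec, sub_dotProduct]
  rw [Matrix.smul_mulVec, dotProduct_smul, Matrix.vecMulVec_mulVec, edgeVec_dotProduct,
    dotProduct_smul, dotProduct_comm, edgeVec_dotProduct, smul_eq_mul, MulOpposite.smul_eq_mul_unop,
    MulOpposite.unop_op, sq]

theorem exists_eigenvalues_eq_spectralGap (hn : 2 ≤ n) (w : Fin n → Fin n → ℝ) :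
    ∃ a b : Fin n, a ≠ b ∧ (wLaplacian_isHermitian w).eigenvalues a = spectralGap hn w ∧
      (wLaplacian_isHermitian w).eigenvalues b ≤ spectralGap hn w ∧
      ∀ i ≠ b, spectralGap hn w ≤ (wLaplacian_isHermitian w).eigenvalues i := by
  set hA := wLaplacian_isHermitian w
  let e : Fin (Fintype.card (Fin n)) ≃ Fin n := Fintype.equivOfCardEq (Fintype.card_fin _)
  have card_eq : Fintype.card (Fin n) = n := Fintype.card_fin n
  have eigenvalues_apply (k) : hA.eigenvalues (e k) = hA.eigenvalues₀ k :=
    congrArg hA.eigenvalues₀ (e.symm_apply_apply k)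
  refine ⟨e ⟨n - 2, by omega⟩, e ⟨n - 1, by omega⟩, ?_, eigenvalues_apply _, ?_, fun i hi => ?_⟩
  · rw [Ne, e.injective.eq_iff, Fin.mk.injEq]
    omega
  · rw [eigenvalues_apply]
    exact hA.eigenvalues₀_antitone (Fin.mk_le_mk.2 (by omega))
  · obtain ⟨k, rfl⟩ := e.surjective i
    rw [Ne, e.injective.eq_iff, Fin.ext_iff] at hi
    rw [eigenvalues_apply]
    exact hA.eigenvalues₀_antitone (Fin.le_def.2 (by grind))

/- Adding a constant to a vector of sum zero leaves the energy unchanged and increases the norm, so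
the bound may be tested on the translate on which the linear form `β` vanishes. -/
theorem hasGap_of_forall_dotProduct_eq_zero {w : Fin n → Fin n → ℝ} {l : ℝ} (hl : 0 < l)
    (hn : 0 < n) (β : Fin n → ℝ)
    (h : ∀ x : Fin n → ℝ, β ⬝ᵥ x = 0 → l * ∑ i, x i ^ 2 ≤ energy w x) : HasGap w l := by
  intro v hv
  set d := β ⬝ᵥ 1
  have d_ne_zero : d ≠ 0 := fun hd => by
    have := h 1 hd
    simp only [Pi.one_apply, one_pow, Finset.sum_const, Finset.card_univ, Fintype.card_fin,
      nsmul_eq_mul, mul_one, energy, sub_self, zero_pow two_ne_zero, mul_zero, zero_div] at this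
    exact this.not_gt (by positivity)
  have energy_shift : energy w (d • v - (β ⬝ᵥ v) • 1) = d ^ 2 * energy w v := by
    simp only [energy, mul_div_assoc', Finset.mul_sum]
    refine congrArg (· / 2) (Finset.sum_congr rfl fun i _ => Finset.sum_congr rfl fun j _ => ?_)
    simp only [Pi.sub_apply, Pi.smul_apply, smul_eq_mul, Pi.one_apply]
    ring
  have sum_sq_shift : d ^ 2 * ∑ i, v i ^ 2 ≤ ∑ i, (d • v - (β ⬝ᵥ v) • 1) i ^ 2 := by
    have expand : ∑ i, (d • v - (β ⬝ᵥ v) • 1) i ^ 2 =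
        d ^ 2 * ∑ i, v i ^ 2 - 2 * d * (β ⬝ᵥ v) * ∑ i, v i + n * (β ⬝ᵥ v) ^ 2 := by
      simp only [Pi.sub_apply, Pi.smul_apply, smul_eq_mul, Pi.one_apply, mul_one, sub_sq, mul_pow,
        Finset.sum_add_distrib, Finset.sum_sub_distrib, Finset.mul_sum, Finset.sum_const,
        Finset.card_univ, Fintype.card_fin, nsmul_eq_mul]
      congr! 3
      ring
    rw [expand, hv, mul_zero, sub_zero]
    exact le_add_of_nonneg_right (by positivity)
  refine le_of_mul_le_mul_left ?_ (show 0 < d ^ 2 by positivity)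
  rw [mul_left_comm, ← energy_shift]
  refine (mul_le_mul_of_nonneg_left sum_sq_shift hl.le).trans (h _ ?_)
  rw [dotProduct_sub, dotProduct_smul, dotProduct_smul, smul_eq_mul, smul_eq_mul, mul_comm,
    sub_self]

theorem hasGap_spectralGap (hn : 2 ≤ n) {w : Fin n → Fin n → ℝ} (hs : ∀ i j, w i j = w j i)
    (h0 : ∀ i j, 0 ≤ w i j) : HasGap w (spectralGap hn w) := by
  rcases le_or_gt (spectralGap hn w) 0 with hgap | hgap
  · exact fun v _ => (mul_nonpos_of_nonpos_of_nonneg hgap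
      (Finset.sum_nonneg fun _ _ => sq_nonneg _)).trans (energy_nonneg h0 v)
  obtain ⟨-, b, -, -, -, hb⟩ := exists_eigenvalues_eq_spectralGap hn w
  refine hasGap_of_forall_dotProduct_eq_zero hgap (by omega)
    ((wLaplacian_isHermitian w).eigenvectorBasis b).ofLp fun x hx => ?_
  rw [← dotProduct_wLaplacian_mulVec_self hs]
  exact mul_sum_sq_le_dotProduct_mulVec _ hb hx

theorem exists_energy_le_spectralGap (hn : 2 ≤ n) {w : Fin n → Fin n → ℝ}
    (hs : ∀ i j, w i j = w j i) :
    ∃ v : Fin n → ℝ, ∑ i, v i = 0 ∧ 0 < ∑ i, v i ^ 2 ∧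
      energy w v ≤ spectralGap hn w * ∑ i, v i ^ 2 := by
  obtain ⟨a, b, hab, ha, hb, -⟩ := exists_eigenvalues_eq_spectralGap hn w
  simpa only [one_dotProduct, dotProduct_wLaplacian_mulVec_self hs] using
    exists_dotProduct_eq_zero_and_dotProduct_mulVec_le (wLaplacian_isHermitian w) hab ha.le hb 1

theorem algebraicConnectivity_eq_spectralGap (hn : 2 ≤ n) {w : Fin n → Fin n → ℝ}
    (hs : ∀ i j, w i j = w j i) (h0 : ∀ i j, 0 ≤ w i j) :
    algebraicConnectivity w = spectralGap hn w := by
  have : Nontrivial (Fin n) := Fin.nontrivial_iff_two_le.2 hn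
  obtain ⟨v, hv, hpos, hle⟩ := exists_energy_le_spectralGap hn hs
  exact le_antisymm ((le_algebraicConnectivity_iff.1 le_rfl).le_of_energy_le hv hpos hle)
    (le_algebraicConnectivity_iff.2 (hasGap_spectralGap hn hs h0))

theorem eq_of_supportGraph_connected {w : Fin n → Fin n → ℝ} (hc : (supportGraph w).Connected)
    {u : Fin n → ℝ} (hu : ∀ i j, w i j ≠ 0 → u i = u j) (i j : Fin n) : u i = u j := by
  obtain ⟨walk⟩ := hc.preconnected i j
  induction walk with
  | nil => rfl
  | cons hadj _ ih =>
    rw [← ih]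
    rcases ((SimpleGraph.fromRel_adj _ _ _).1 hadj).2 with h | h
    · exact hu _ _ h
    · exact (hu _ _ h).symm

theorem spectralGap_pos (hn : 2 ≤ n) {w : Fin n → Fin n → ℝ} (hs : ∀ i j, w i j = w j i)
    (h0 : ∀ i j, 0 ≤ w i j) (hc : (supportGraph w).Connected) : 0 < spectralGap hn w := by
  obtain ⟨v, hv, hpos, hle⟩ := exists_energy_le_spectralGap hn hs
  by_contra hgap
  have term_nonneg (i j : Fin n) : 0 ≤ w i j * (v i - v j) ^ 2 :=
    mul_nonneg (h0 i j) (sq_nonneg _)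
  have energy_eq_zero : energy w v = 0 := le_antisymm
    (hle.trans (mul_nonpos_of_nonpos_of_nonneg (not_lt.1 hgap) hpos.le)) (energy_nonneg h0 v)
  rw [energy, div_eq_zero_iff, or_iff_left two_ne_zero, Fintype.sum_eq_zero_iff_of_nonneg
    fun i => Finset.sum_nonneg fun j _ => term_nonneg i j] at energy_eq_zero
  have const : ∀ i j, v i = v j := eq_of_supportGraph_connected hc fun i j hw => by
    have row_eq_zero := congrFun energy_eq_zero i
    rw [Pi.zero_apply, Finset.sum_eq_zero_iff_of_nonneg fun j _ => term_nonneg i j] at row_eq_zero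
    simpa [hw, sub_eq_zero] using row_eq_zero j (Finset.mem_univ j)
  have eq_zero (k : Fin n) : v k = 0 := by
    rw [Finset.sum_congr rfl fun i _ => const i k] at hv
    simpa [show n ≠ 0 by omega] using hv
  simp [eq_zero] at hpos

end SpectralGap

/-! ### The noise of the comparisons -/

section Noise

theorem isSubGaussianVector_of_iIndepFun {ι Ω : Type*} [Fintype ι] [MeasurableSpace Ω]
    {μ : Measure Ω} {X : ι → Ω → ℝ} (hX : iIndepFun X μ) {c : NNReal}
    (hsub : ∀ i, HasSubgaussianMGF (X i) c μ) : IsSubGaussianVector μ (fun ω i => X i ω) c := by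
  intro t
  have sum_sub : HasSubgaussianMGF (fun ω => ∑ i, t i * X i ω) _ μ :=
    HasSubgaussianMGF.sum_of_iIndepFun (s := Finset.univ)
      (hX.comp (fun i x => t i * x) fun i => measurable_const_mul (t i))
      fun i _ => (hsub i).const_mul (t i)
  have mgf_le := sum_sub.mgf_le 1
  have integrable := sum_sub.integrable_exp_mul 1
  simp only [mgf, one_mul] at mgf_le integrable
  rw [← ofReal_integral_eq_lintegral_ofReal integrable (ae_of_all _ fun _ => (Real.exp_pos _).le)]
  refine ENNReal.ofReal_le_ofReal (mgf_le.trans_eq ?_)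
  rw [NNReal.coe_sum, one_pow, mul_one, mul_comm (c : ℝ), Finset.sum_mul]
  rfl

variable {n L : ℕ} {G : SimpleGraph (Fin n)}

theorem sum_comparisonIdx [DecidableRel G.Adj] (f : Fin n → Fin n → Fin L → ℝ)
    (hf : ∀ i j l, ¬ G.Adj i j → f i j l = 0) :
    ∑ q : ComparisonIdx G L, f q.1.1.1 q.1.1.2 q.2 =
      ∑ i, ∑ j ∈ Finset.univ.filter (fun j => j < i), ∑ l, f i j l := by
  rw [Fintype.sum_prod_type, ← Finset.sum_subtype
    (Finset.univ.filter fun p : Fin n × Fin n => p.2 < p.1 ∧ G.Adj p.1 p.2)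
    (fun x => by simp) (fun p => ∑ l, f p.1 p.2 l), Finset.sum_filter, Fintype.sum_prod_type]
  refine Finset.sum_congr rfl fun i _ => ?_
  rw [Finset.sum_filter]
  refine Finset.sum_congr rfl fun j _ => ?_
  by_cases hadj : G.Adj i j
  · simp only [hadj, and_true]
  · simp only [hadj, and_false, hf i j _ hadj, Finset.sum_const_zero, ite_self]

/-- The empirical frequencies as a function of the observed outcomes only: on pairs that are not
compared, every outcome is replaced by `false`. -/
noncomputable def observedFreq (G : SimpleGraph (Fin n)) [DecidableRel G.Adj]
    (o : ComparisonIdx G L → Bool) : Fin n → Fin n → ℝ :=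
  winFreq fun i j l => if h : j < i ∧ G.Adj i j then o ⟨⟨(i, j), h⟩, l⟩ else false

variable {Ω : Type*} {y : Fin n → Fin n → Fin L → Ω → Bool} {w : Fin n → Fin n → ℝ}
  {θ : Fin n → ℝ}

theorem score_observedFreq [DecidableRel G.Adj] (hw : ∀ i j, ¬ G.Adj i j → w i j = 0) (ω : Ω) :
    score w (observedFreq G (observed G y ω)) θ = score w (winFreq fun i j l => y i j l ω) θ := by
  funext i
  refine Finset.sum_congr rfl fun j _ => ?_
  by_cases hadj : G.Adj i j
  · rcases lt_trichotomy i j with h | rfl | h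
    · simp only [observedFreq, winFreq, h, h.asymm, if_false, if_true, hadj.symm, and_self, dif_pos,
        observed]
    · simp only [observedFreq, winFreq, lt_self_iff_false, if_false]
    · simp only [observedFreq, winFreq, h, if_true, hadj, and_self, dif_pos, observed]
  · rw [hw i j hadj, zero_mul, zero_mul]

theorem isCritical_observedFreq_iff [DecidableRel G.Adj] (hw : ∀ i j, ¬ G.Adj i j → w i j = 0)
    (ω : Ω) : IsCritical w (observedFreq G (observed G y ω)) θ ↔
      IsCritical w (winFreq fun i j l => y i j l ω) θ := by
  simp only [isCritical_iff_score_eq_zero, score_observedFreq hw]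

theorem sum_mul_score_winFreq [DecidableRel G.Adj] (hL : 0 < L) (hs : ∀ i j, w i j = w j i)
    (hw : ∀ i j, ¬ G.Adj i j → w i j = 0) (u : Fin n → ℝ) (ω : Ω) :
    ∑ i, u i * score w (winFreq fun i j l => y i j l ω) θ i =
      ∑ q : ComparisonIdx G L, w q.1.1.1 q.1.1.2 / L * (u q.1.1.1 - u q.1.1.2) *
        (winRev (observed G y ω q) - Real.sigmoid (θ q.1.1.1 - θ q.1.1.2)) := by
  set p := winFreq fun i j l => y i j l ω
  have antisymm (i j : Fin n) : w i j * (p i j - Real.sigmoid (θ i - θ j)) =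
      -(w j i * (p j i - Real.sigmoid (θ j - θ i))) := by
    have := weight_mul_sigmoid_sub_antisymm hs (winFreq_add_swap fun i j l => y i j l ω) θ i j
    linarith
  refine (sum_mul_sum_of_antisymm antisymm u).trans ((sum_sum_lt_eq_half (fun i j => by
    rw [antisymm, neg_mul_comm, neg_sub]) fun i => by rw [sub_self (u i), mul_zero]).symm.trans ?_)
  refine (Finset.sum_congr rfl fun i _ => Finset.sum_congr rfl fun j hj => ?_).trans
    (sum_comparisonIdx (fun i j l => w i j / L * (u i - u j) *
      (winRev (y i j l ω) - Real.sigmoid (θ i - θ j)))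
      fun i j l h => by rw [hw i j h, zero_div, zero_mul, zero_mul]).symm
  have freq_eq : p i j = (∑ l, winRev (y i j l ω)) / L := winFreq_of_lt _ (Finset.mem_filter.1 hj).2
  rw [← Finset.mul_sum, Finset.sum_sub_distrib, freq_eq, Finset.sum_const,
    Finset.card_univ, Fintype.card_fin, nsmul_eq_mul]
  field_simp

theorem sum_sq_weight_mul_sub_le [DecidableRel G.Adj] (hL : 0 < L) (hs : ∀ i j, w i j = w j i)
    (h0 : ∀ i j, 0 ≤ w i j) (hw : ∀ i j, ¬ G.Adj i j → w i j = 0) {W : ℝ} (hW : ∀ i j, w i j ≤ W)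
    (u : Fin n → ℝ) :
    ∑ q : ComparisonIdx G L, (w q.1.1.1 q.1.1.2 / L * (u q.1.1.1 - u q.1.1.2)) ^ 2 ≤
      W * energy w u / L := by
  refine (sum_comparisonIdx (fun i j (_ : Fin L) => (w i j / L * (u i - u j)) ^ 2)
    fun i j _ h => by rw [hw i j h, zero_div, zero_mul, zero_pow two_ne_zero]).trans_le ?_
  rw [energy, ← sum_sum_lt_eq_half (fun i j => by rw [hs, ← neg_sub, neg_sq]) (fun i => by simp)]
  simp only [Finset.mul_sum, Finset.sum_div, Finset.sum_const, Finset.card_univ, Fintype.card_fin,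
    nsmul_eq_mul]
  refine Finset.sum_le_sum fun i _ => Finset.sum_le_sum fun j _ => ?_
  calc (L : ℝ) * (w i j / L * (u i - u j)) ^ 2 = w i j * (w i j * (u i - u j) ^ 2) / L := by
        field_simp
    _ ≤ W * (w i j * (u i - u j) ^ 2) / L := by
        gcongr
        · exact mul_nonneg (h0 i j) (sq_nonneg _)
        · exact hW i j

variable [MeasurableSpace Ω] {μ : Measure Ω}

theorem measurable_observed (hy : IsBTLSample μ G θ y) : Measurable (observed G y) :=
  measurable_pi_lambda _ fun q => hy.measurable _ _ _ q.1.2.1 q.1.2.2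

theorem measurable_winRev : Measurable winRev := measurable_of_finite _

variable [IsProbabilityMeasure μ]

theorem integral_winRev_observed (hy : IsBTLSample μ G θ y) (q : ComparisonIdx G L) :
    ∫ ω, winRev (observed G y ω q) ∂μ = Real.sigmoid (θ q.1.1.1 - θ q.1.1.2) := by
  have measurableSet_win : MeasurableSet {ω | y q.1.1.1 q.1.1.2 q.2 ω = true} :=
    hy.measurable _ _ _ q.1.2.1 q.1.2.2 (measurableSet_singleton true)
  have winRev_eq (ω : Ω) : winRev (observed G y ω q) =
      1 - Set.indicator {ω | y q.1.1.1 q.1.1.2 q.2 ω = true} (fun _ => (1 : ℝ)) ω := by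
    by_cases h : y q.1.1.1 q.1.1.2 q.2 ω = true <;> simp [winRev, observed, h]
  simp_rw [winRev_eq]
  rw [integral_sub (integrable_const _) ((integrable_const _).indicator measurableSet_win),
    integral_indicator_const _ measurableSet_win, hy.prob _ _ _ q.1.2.1 q.1.2.2, integral_const,
    probReal_univ, one_smul, smul_eq_mul, mul_one, Real.sigmoid_def, neg_sub, Real.exp_sub]
  field_simp
  ring

theorem isSubGaussianVector_winRev_sub_sigmoid [DecidableRel G.Adj] (hy : IsBTLSample μ G θ y) :
    IsSubGaussianVector μ (fun ω (q : ComparisonIdx G L) =>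
      winRev (observed G y ω q) - Real.sigmoid (θ q.1.1.1 - θ q.1.1.2)) (1 / 4) := by
  have sub_gaussian (q : ComparisonIdx G L) : HasSubgaussianMGF
      (fun ω => winRev (observed G y ω q) - Real.sigmoid (θ q.1.1.1 - θ q.1.1.2)) (1 / 4) μ := by
    have param_eq : (1 / 4 : NNReal) = (‖(1 : ℝ) - 0‖₊ / 2) ^ 2 := by
      rw [sub_zero, nnnorm_one, div_pow, one_pow]
      norm_num
    rw [← integral_winRev_observed hy, param_eq]
    exact hasSubgaussianMGF_of_mem_Icc
      (measurable_winRev.comp ((measurable_pi_apply q).comp (measurable_observed hy))).aemeasurable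
      (ae_of_all _ fun ω => by rw [winRev]; split_ifs <;> simp)
  have := isSubGaussianVector_of_iIndepFun (hy.indep.comp
    (fun q b => winRev b - Real.sigmoid (θ q.1.1.1 - θ q.1.1.2)) fun _ => measurable_of_finite _)
    sub_gaussian
  rwa [NNReal.coe_div, NNReal.coe_one, NNReal.coe_ofNat] at this

theorem isSubGaussianVector_newtonStep [DecidableRel G.Adj] [NeZero n] (hy : IsBTLSample μ G θ y)
    (hL : 0 < L) (hs : ∀ i j, w i j = w j i) (h0 : ∀ i j, 0 ≤ w i j)
    (hw : ∀ i j, ¬ G.Adj i j → w i j = 0) {W c l : ℝ} (hW : ∀ i j, w i j ≤ W)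
    (hc : ∀ i j, w i j ≤ c * hessWeight w θ i j) (hc0 : 0 ≤ c) (hl : 0 < l)
    (hz : HasGap (hessWeight w θ) l) :
    IsSubGaussianVector μ (fun ω => newtonStep w (observedFreq G (observed G y ω)) θ)
      (W * c / (4 * l * L)) := by
  intro t
  simp_rw [newtonStep, sum_mul_poisson_comm (hessWeight_symm hs θ) hl hz t, score_observedFreq hw,
    mul_comm (score _ _ _ _), sum_mul_score_winFreq hL hs hw]
  refine (isSubGaussianVector_winRev_sub_sigmoid hy _).trans
    (ENNReal.ofReal_le_ofReal (Real.exp_le_exp.2 (div_le_div_of_nonneg_right ?_ two_pos.le)))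
  set u := poisson (hessWeight w θ) t
  have W_nonneg : 0 ≤ W := (h0 0 0).trans (hW 0 0)
  have energy_le : energy w u ≤ c * ((∑ i, t i ^ 2) / l) :=
    (energy_le_mul_energy hc u).trans (mul_le_mul_of_nonneg_left
      (energy_poisson_le (hessWeight_symm hs θ) hl hz t) hc0)
  calc 1 / 4 * ∑ q : ComparisonIdx G L, (w q.1.1.1 q.1.1.2 / L * (u q.1.1.1 - u q.1.1.2)) ^ 2
      ≤ 1 / 4 * (W * energy w u / L) :=
        mul_le_mul_of_nonneg_left (sum_sq_weight_mul_sub_le hL hs h0 hw hW u) (by norm_num)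
    _ ≤ 1 / 4 * (W * (c * ((∑ i, t i ^ 2) / l)) / L) := by gcongr
    _ = W * c / (4 * l * L) * ∑ i, t i ^ 2 := by field_simp

end Noise

/-! ### The Newton step at the true scores -/

section GreenFlow

variable {V : Type*} [Fintype V] [DecidableEq V] {w z : V → V → ℝ} {D l : ℝ}

theorem greenFlow_le [Nonempty V] (h0 : ∀ i j, 0 ≤ w i j) (hD : ∀ i, ∑ j, w i j ≤ D)
    (hs : ∀ i j, z i j = z j i) (hl : 0 < l) (hz : HasGap z l) (k i : V) :
    greenFlow w z k i ≤ 2 * D / l :=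
  calc greenFlow w z k i ≤ ∑ j, w i j * (1 / l + 1 / l) :=
        Finset.sum_le_sum fun j _ => mul_le_mul_of_nonneg_left
          ((abs_sub _ _).trans (add_le_add (abs_green_le hs hl hz k i) (abs_green_le hs hl hz k j)))
          (h0 i j)
    _ = (∑ j, w i j) * (1 / l + 1 / l) := (Finset.sum_mul _ _ _).symm
    _ ≤ D * (1 / l + 1 / l) := mul_le_mul_of_nonneg_right (hD i) (by positivity)
    _ = 2 * D / l := by ring

theorem sum_greenFlow_le (hs : ∀ i j, w i j = w j i) (h0 : ∀ i j, 0 ≤ w i j)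
    (hD : ∀ i, ∑ j, w i j ≤ D) (z : V → V → ℝ) (k : V) :
    ∑ i, greenFlow w z k i ≤ 2 * D * ∑ i, |green z k i| :=
  calc ∑ i, greenFlow w z k i ≤ ∑ i, ∑ j, w i j * (|green z k i| + |green z k j|) :=
        Finset.sum_le_sum fun i _ => Finset.sum_le_sum fun j _ =>
          mul_le_mul_of_nonneg_left (abs_sub _ _) (h0 i j)
    _ = 2 * ∑ i, (∑ j, w i j) * |green z k i| := sum_sum_mul_add_of_symm hs _
    _ ≤ 2 * ∑ i, D * |green z k i| := by
        gcongr with i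
        exact hD i
    _ = 2 * D * ∑ i, |green z k i| := by rw [← Finset.mul_sum, mul_assoc]

end GreenFlow

section Measurability

theorem measurable_hessWeight {V : Type*} (θ : V → ℝ) :
    Measurable fun w : V → V → ℝ => hessWeight w θ := by
  unfold hessWeight
  fun_prop

variable {V : Type*} [Fintype V] [DecidableEq V]

variable {α : Type*} [MeasurableSpace α] {z w : α → V → V → ℝ}

theorem measurable_poisson (hz : Measurable z) {t : α → V → ℝ} (ht : Measurable t) :
    Measurable fun a => poisson (z a) (t a) := by
  have continuous_lapMatrix : Continuous fun z : V → V → ℝ => lapMatrix z := by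
    refine continuous_matrix fun a b => ?_
    simp only [lapMatrix, Matrix.add_apply, Matrix.sub_apply, Matrix.of_apply,
      Matrix.diagonal_apply]
    split_ifs <;> fun_prop
  have measurable_inv (a b : V) : Measurable fun z : V → V → ℝ => (lapMatrix z)⁻¹ a b := by
    simp only [Matrix.inv_def, Matrix.smul_apply, Ring.inverse_eq_inv', smul_eq_mul]
    exact continuous_lapMatrix.matrix_det.measurable.inv.mul
      (continuous_lapMatrix.matrix_adjugate.matrix_elem a b).measurable
  refine measurable_pi_lambda _ fun i => ?_
  simp only [poisson, Matrix.mulVec, dotProduct]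
  refine (Finset.measurable_sum _ fun j _ => ?_).sub (by fun_prop)
  exact ((measurable_inv i j).comp hz).mul (by fun_prop)

theorem measurable_newtonStep (hw : Measurable w) {p : α → V → V → ℝ} (hp : Measurable p)
    (θ : V → ℝ) : Measurable fun a => newtonStep (w a) (p a) θ := by
  have measurable_score : Measurable fun a => score (w a) (p a) θ := by
    unfold score
    fun_prop
  exact measurable_poisson ((measurable_hessWeight θ).comp hw) measurable_score

theorem measurable_greenFlow_hessWeight (hw : Measurable w) (θ : V → ℝ) (k i : V) :
    Measurable fun a => greenFlow (w a) (hessWeight (w a) θ) k i := by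
  have measurable_green : Measurable fun a => green (hessWeight (w a) θ) k :=
    measurable_poisson ((measurable_hessWeight θ).comp hw) measurable_const
  unfold greenFlow
  fun_prop

end Measurability

section TrueScores

variable {n : ℕ} {w : Fin n → Fin n → ℝ} {θ : Fin n → ℝ}

theorem condNumber_pos (hn : 2 ≤ n) (θ : Fin n → ℝ) : 0 < condNumber hn θ :=
  div_pos (Real.exp_pos _) (Real.exp_pos _)

theorem le_mul_hessWeight (hn : 2 ≤ n) (hθ : Antitone θ) (h0 : ∀ i j, 0 ≤ w i j) (i j : Fin n) :
    w i j ≤ 4 * condNumber hn θ * hessWeight w θ i j := by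
  set first : Fin n := ⟨0, by omega⟩
  set last : Fin n := ⟨n - 1, by omega⟩
  have le_first (i : Fin n) : θ i ≤ θ first := hθ (Fin.mk_le_mk.2 (Nat.zero_le _))
  have last_le (i : Fin n) : θ last ≤ θ i := hθ (Fin.mk_le_mk.2 (by omega))
  have deriv_ge : 1 / (4 * condNumber hn θ) ≤ sigmoidDeriv (θ i - θ j) := by
    have := exp_neg_div_four_le_sigmoidDeriv (x := θ i - θ j) (b := θ first - θ last)
      (abs_sub_le_iff.2 ⟨sub_le_sub (le_first i) (last_le j), sub_le_sub (le_first j) (last_le i)⟩)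
    rwa [Real.exp_neg, Real.exp_sub, ← one_div, div_div, mul_comm] at this
  have := mul_le_mul_of_nonneg_left deriv_ge (h0 i j)
  rwa [mul_one_div, div_le_iff₀' (mul_pos four_pos (condNumber_pos hn θ))] at this

theorem hasGap_hessWeight (hn : 2 ≤ n) (hθ : Antitone θ) (h0 : ∀ i j, 0 ≤ w i j) {l : ℝ}
    (hl : HasGap w l) : HasGap (hessWeight w θ) (l / (4 * condNumber hn θ)) := fun v hv => by
  rw [div_mul_eq_mul_div, div_le_iff₀' (mul_pos four_pos (condNumber_pos hn θ))]
  exact (hl v hv).trans (energy_le_mul_energy (le_mul_hessWeight hn hθ h0) v)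

theorem sum_le_dMax (hdiag : ∀ i, w i i = 0) (i : Fin n) : ∑ j, w i j ≤ dMax w := by
  have degree_eq : ∑ j, w i j = wDegree w i := by
    rw [wDegree, Finset.sum_filter_of_ne]
    rintro j - hj rfl
    exact hj (hdiag j)
  rw [degree_eq]
  exact le_ciSup (Set.finite_range _).bddAbove i

theorem le_wMax (w : Fin n → Fin n → ℝ) (i j : Fin n) : w i j ≤ wMax w :=
  le_ciSup (f := fun p : Fin n × Fin n => w p.1 p.2) (Set.finite_range _).bddAbove (i, j)

theorem measurable_wMax : Measurable (wMax : (Fin n → Fin n → ℝ) → ℝ) :=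
  Measurable.iSup fun p => by fun_prop

theorem measurable_dMax : Measurable (dMax : (Fin n → Fin n → ℝ) → ℝ) := by
  unfold dMax wDegree
  exact Measurable.iSup fun p => by fun_prop

end TrueScores

/-- Weights supported on `G` whose positive weights form a connected graph: the weights to which the
analysis of the weighted MLE applies. -/
structure IsConnectedWeighting {n : ℕ} (G : SimpleGraph (Fin n)) (w : Fin n → Fin n → ℝ) : Prop
    extends IsWeighting G w where
  connected : (supportGraph w).Connected

namespace IsConnectedWeighting

variable {n : ℕ} {G : SimpleGraph (Fin n)} {w : Fin n → Fin n → ℝ} {θ : Fin n → ℝ}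

theorem diag (hw : IsConnectedWeighting G w) (i : Fin n) : w i i = 0 :=
  hw.supported i i G.irrefl

variable (hw : IsConnectedWeighting G w) (hn : 2 ≤ n)
include hw

theorem hasGap : HasGap w (spectralGap hn w) :=
  hasGap_spectralGap hn hw.symm hw.nonneg

theorem gap_pos : 0 < spectralGap hn w :=
  spectralGap_pos hn hw.symm hw.nonneg hw.connected

theorem algebraicConnectivity_eq : algebraicConnectivity w = spectralGap hn w :=
  algebraicConnectivity_eq_spectralGap hn hw.symm hw.nonneg

theorem gap_le : spectralGap hn w ≤ 2 * dMax w :=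
  have : Nontrivial (Fin n) := Fin.nontrivial_iff_two_le.2 hn
  gap_le_of_degree_le hw.symm hw.nonneg (sum_le_dMax hw.diag) (hw.hasGap hn)

include hn in
theorem dMax_pos : 0 < dMax w :=
  pos_of_mul_pos_right ((hw.gap_pos hn).trans_le (hw.gap_le hn)) two_pos.le

include hn in
theorem wMax_pos : 0 < wMax w := by
  have : Nontrivial (Fin n) := Fin.nontrivial_iff_two_le.2 hn
  by_contra hW
  have degree_nonpos (i : Fin n) : ∑ j, w i j ≤ 0 :=
    Finset.sum_nonpos fun j _ => (le_wMax w i j).trans (not_lt.1 hW)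
  have := gap_le_of_degree_le hw.symm hw.nonneg degree_nonpos (hw.hasGap hn)
  exact (hw.gap_pos hn).not_ge (this.trans_eq (mul_zero 2))

theorem hess_gap_pos (θ : Fin n → ℝ) : 0 < spectralGap hn w / (4 * condNumber hn θ) :=
  div_pos (hw.gap_pos hn) (mul_pos four_pos (condNumber_pos hn θ))

variable (hθ : Antitone θ)
include hθ

theorem hess_hasGap : HasGap (hessWeight w θ) (spectralGap hn w / (4 * condNumber hn θ)) :=
  hasGap_hessWeight hn hθ hw.nonneg (hw.hasGap hn)

theorem greenFlow_le (k i : Fin n) : greenFlow w (hessWeight w θ) k i ≤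
    8 * (condNumber hn θ * dMax w / spectralGap hn w) := by
  have : NeZero n := ⟨by omega⟩
  refine (BTL.greenFlow_le hw.nonneg (sum_le_dMax hw.diag) (hessWeight_symm hw.symm θ)
    (hw.hess_gap_pos hn θ) (hw.hess_hasGap hn hθ) k i).trans_eq ?_
  rw [div_div_eq_mul_div]
  ring

theorem sum_greenFlow_le (k : Fin n) : ∑ i, greenFlow w (hessWeight w θ) k i ≤
    56 * (condNumber hn θ * dMax w / spectralGap hn w) * Real.log n := by
  have : Nontrivial (Fin n) := Fin.nontrivial_iff_two_le.2 hn
  have dMax_pos := hw.dMax_pos hn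
  have hess_le (i j : Fin n) : hessWeight w θ i j ≤ w i j :=
    mul_le_of_le_one_right (hw.nonneg i j) ((sigmoidDeriv_le _).trans (by norm_num))
  have sum_green_le := sum_abs_green_le (hessWeight_symm hw.symm θ)
    (fun i j => mul_nonneg (hw.nonneg i j) (sigmoidDeriv_nonneg _)) dMax_pos
    (fun i => (Finset.sum_le_sum fun j _ => hess_le i j).trans (sum_le_dMax hw.diag i))
    (hw.hess_gap_pos hn θ) (hw.hess_hasGap hn hθ) k
  rw [Fintype.card_fin] at sum_green_le
  calc ∑ i, greenFlow w (hessWeight w θ) k i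
      ≤ 2 * dMax w * ∑ i, |green (hessWeight w θ) k i| :=
        BTL.sum_greenFlow_le hw.symm hw.nonneg (sum_le_dMax hw.diag) _ k
    _ ≤ 2 * dMax w * (7 * Real.log n / (spectralGap hn w / (4 * condNumber hn θ))) := by gcongr
    _ = _ := by
        rw [div_div_eq_mul_div]
        ring

end IsConnectedWeighting

/-! ### The good event -/

/-- The variance proxy of the Newton step at the true scores `θ` for the weights `w`. The spectral
gap enters through `algebraicConnectivity`, whose measurability is easy to see. -/
noncomputable def noiseVariance {n : ℕ} (hn : 2 ≤ n) (L : ℕ) (θ : Fin n → ℝ)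
    (w : Fin n → Fin n → ℝ) : ℝ :=
  4 * condNumber hn θ ^ 2 * wMax w / (algebraicConnectivity w * L)

/-- The bound imposed on the good event on `∑ i, greenFlow w _ k i * newtonStep w p θ i ^ 2`, the
size of the second order terms of the gradient after one Newton step. -/
noncomputable def secondOrderBound {n : ℕ} (hn : 2 ≤ n) (L : ℕ) (θ : Fin n → ℝ)
    (w : Fin n → Fin n → ℝ) : ℝ :=
  496 * noiseVariance hn L θ w * (condNumber hn θ * dMax w / algebraicConnectivity w) * Real.log n

/-- The pairs of weights and empirical frequencies for which the Newton step at the true scores `θ`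
is as small as its typical size, both pointwise and in the norms weighted by the Green flows. -/
def goodSet {n : ℕ} (hn : 2 ≤ n) (L : ℕ) (θ : Fin n → ℝ) :
    Set ((Fin n → Fin n → ℝ) × (Fin n → Fin n → ℝ)) :=
  {q | ∀ k, newtonStep q.1 q.2 θ k ^ 2 ≤ 51 * noiseVariance hn L θ q.1 * Real.log n ∧
    ∑ i, greenFlow q.1 (hessWeight q.1 θ) k i * newtonStep q.1 q.2 θ i ^ 2 ≤
      secondOrderBound hn L θ q.1}

variable {n L : ℕ} {θ : Fin n → ℝ}

theorem measurableSet_goodSet (hn : 2 ≤ n) (L : ℕ) (θ : Fin n → ℝ) :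
    MeasurableSet (goodSet hn L θ) := by
  have : Nontrivial (Fin n) := Fin.nontrivial_iff_two_le.2 hn
  have measurable_noiseVariance : Measurable (noiseVariance hn L θ) :=
    (measurable_wMax.const_mul _).div (measurable_algebraicConnectivity.mul_const _)
  have measurable_secondOrderBound : Measurable (secondOrderBound hn L θ) :=
    ((measurable_noiseVariance.const_mul _).mul
      ((measurable_dMax.const_mul _).div measurable_algebraicConnectivity)).mul_const _
  have measurable_step (k : Fin n) :
      Measurable fun q : (Fin n → Fin n → ℝ) × (Fin n → Fin n → ℝ) =>
        newtonStep q.1 q.2 θ k ^ 2 :=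
    ((measurable_pi_apply k).comp
      (measurable_newtonStep measurable_fst measurable_snd θ)).pow_const 2
  simp only [goodSet, Set.ofPred_forall, Set.ofPred_and]
  refine MeasurableSet.iInter fun k => (measurableSet_le (measurable_step k) ?_).inter
    (measurableSet_le (Finset.measurable_sum _ fun i _ =>
      (measurable_greenFlow_hessWeight measurable_fst θ k i).mul (measurable_step i))
      (measurable_secondOrderBound.comp measurable_fst))
  exact ((measurable_noiseVariance.comp measurable_fst).const_mul _).mul_const _

theorem measurable_observedFreq (G : SimpleGraph (Fin n)) [DecidableRel G.Adj] :
    Measurable (observedFreq G : (ComparisonIdx G L → Bool) → Fin n → Fin n → ℝ) :=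
  measurable_of_finite _

theorem measurable_newtonStep_observedFreq {Ω : Type*} [MeasurableSpace Ω] {μ : Measure Ω}
    {G : SimpleGraph (Fin n)} [DecidableRel G.Adj] {y : Fin n → Fin n → Fin L → Ω → Bool}
    (hy : IsBTLSample μ G θ y) (w : Fin n → Fin n → ℝ) :
    Measurable fun ω => newtonStep w (observedFreq G (observed G y ω)) θ :=
  measurable_newtonStep measurable_const
    ((measurable_observedFreq G).comp (measurable_observed hy)) θ

theorem two_div_three_le_log (hn : 2 ≤ n) : 2 / 3 ≤ Real.log n := by
  have := Real.log_le_log two_pos (Nat.ofNat_le_cast.2 hn : (2 : ℝ) ≤ n)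
  linarith [Real.log_two_gt_d9]

namespace IsConnectedWeighting

variable {G : SimpleGraph (Fin n)} {w : Fin n → Fin n → ℝ}
variable (hw : IsConnectedWeighting G w) (hn : 2 ≤ n)
include hw

theorem noiseVariance_eq (L : ℕ) (θ : Fin n → ℝ) : noiseVariance hn L θ w =
    4 * condNumber hn θ ^ 2 * wMax w / (spectralGap hn w * L) := by
  rw [noiseVariance, hw.algebraicConnectivity_eq hn]

theorem noiseVariance_pos (hL : 0 < L) (θ : Fin n → ℝ) : 0 < noiseVariance hn L θ w := by
  have := hw.gap_pos hn
  have := hw.wMax_pos hn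
  have := condNumber_pos hn θ
  rw [hw.noiseVariance_eq hn]
  positivity

variable {Ω : Type*} [MeasurableSpace Ω] {μ : Measure Ω} [IsProbabilityMeasure μ]
  {y : Fin n → Fin n → Fin L → Ω → Bool} [DecidableRel G.Adj]

theorem isSubGaussianVector_newtonStep (hL : 0 < L) (hθ : Antitone θ) (hy : IsBTLSample μ G θ y) :
    IsSubGaussianVector μ (fun ω => newtonStep w (observedFreq G (observed G y ω)) θ)
      (noiseVariance hn L θ w) := by
  have : NeZero n := ⟨by omega⟩
  have κ_pos := condNumber_pos hn θ
  have gap_pos := hw.gap_pos hn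
  convert BTL.isSubGaussianVector_newtonStep hy hL hw.symm hw.nonneg hw.supported (le_wMax w)
    (le_mul_hessWeight hn hθ hw.nonneg) (by positivity) (hw.hess_gap_pos hn θ)
    (hw.hess_hasGap hn hθ) using 1
  rw [hw.noiseVariance_eq hn]
  field_simp

theorem measure_lt_newtonStep_sq_le (hL : 0 < L) (hθ : Antitone θ) (hy : IsBTLSample μ G θ y)
    (k : Fin n) :
    μ {ω | 51 * noiseVariance hn L θ w * Real.log n <
        newtonStep w (observedFreq G (observed G y ω)) θ k ^ 2} ≤
      ENNReal.ofReal (Real.exp (-(12 * Real.log n))) := by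
  have noise_pos := hw.noiseVariance_pos hn hL θ
  have le_log := two_div_three_le_log hn
  refine (measure_mono fun ω hω => ?_).trans
    ((hw.isSubGaussianVector_newtonStep hn hL hθ hy).measure_lt_sq_le
      (measurable_newtonStep_observedFreq hy w) noise_pos k (12 * Real.log n))
  rw [Set.mem_ofPred_eq] at hω ⊢
  refine lt_of_le_of_lt ?_ hω
  nlinarith

theorem measure_lt_sum_greenFlow_mul_newtonStep_sq_le (hL : 0 < L) (hθ : Antitone θ)
    (hy : IsBTLSample μ G θ y) (k : Fin n) :
    μ {ω | secondOrderBound hn L θ w < ∑ i, greenFlow w (hessWeight w θ) k i *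
        newtonStep w (observedFreq G (observed G y ω)) θ i ^ 2} ≤
      ENNReal.ofReal (Real.exp (-(12 * Real.log n))) := by
  have noise_pos := hw.noiseVariance_pos hn hL θ
  have ratio_pos : 0 < condNumber hn θ * dMax w / spectralGap hn w :=
    div_pos (mul_pos (condNumber_pos hn θ) (hw.dMax_pos hn)) (hw.gap_pos hn)
  refine (measure_mono fun ω hω => ?_).trans
    ((hw.isSubGaussianVector_newtonStep hn hL hθ hy).measure_lt_sum_mul_sq_le
      (measurable_newtonStep_observedFreq hy w) noise_pos (greenFlow_nonneg hw.nonneg _ k)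
      (mul_pos (by norm_num : (0 : ℝ) < 8) ratio_pos) (hw.greenFlow_le hn hθ k) (12 * Real.log n))
  rw [Set.mem_ofPred_eq] at hω ⊢
  refine lt_of_le_of_lt ?_ hω
  rw [secondOrderBound, hw.algebraicConnectivity_eq hn]
  have := mul_le_mul_of_nonneg_left (hw.sum_greenFlow_le hn hθ k) noise_pos.le
  linarith

theorem measure_notMem_goodSet_le (hL : 0 < L) (hθ : Antitone θ) (hy : IsBTLSample μ G θ y) :
    μ {ω | (w, observedFreq G (observed G y ω)) ∉ goodSet hn L θ} ≤
      ENNReal.ofReal (1 / (n : ℝ) ^ 10) := by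
  have two_le : (2 : ℝ) ≤ n := Nat.ofNat_le_cast.2 hn
  have exp_eq : Real.exp (-(12 * Real.log n)) = 1 / (n : ℝ) ^ 12 := by
    rw [Real.exp_neg, mul_comm, Real.exp_mul, Real.exp_log (by linarith), one_div]
    norm_cast
  calc μ {ω | (w, observedFreq G (observed G y ω)) ∉ goodSet hn L θ}
      ≤ ∑ k, (μ {ω | 51 * noiseVariance hn L θ w * Real.log n <
            newtonStep w (observedFreq G (observed G y ω)) θ k ^ 2} +
          μ {ω | secondOrderBound hn L θ w < ∑ i, greenFlow w (hessWeight w θ) k i *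
            newtonStep w (observedFreq G (observed G y ω)) θ i ^ 2}) := by
        refine (measure_mono fun ω hω => ?_).trans ((measure_iUnion_fintype_le μ _).trans
          (Finset.sum_le_sum fun k _ => measure_union_le _ _))
        simpa only [goodSet, Set.mem_ofPred_eq, not_forall, not_and_or, not_le, Set.mem_iUnion,
          Set.mem_union] using hω
    _ ≤ ∑ _ : Fin n, (ENNReal.ofReal (1 / (n : ℝ) ^ 12) + ENNReal.ofReal (1 / (n : ℝ) ^ 12)) := by
        rw [← exp_eq]
        gcongr with k
        · exact hw.measure_lt_newtonStep_sq_le hn hL hθ hy k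
        · exact hw.measure_lt_sum_greenFlow_mul_newtonStep_sq_le hn hL hθ hy k
    _ = ENNReal.ofReal (n * (1 / (n : ℝ) ^ 12 + 1 / (n : ℝ) ^ 12)) := by
        rw [Finset.sum_const, Finset.card_univ, Fintype.card_fin, nsmul_eq_mul,
          ← ENNReal.ofReal_add (by positivity) (by positivity), ← ENNReal.ofReal_natCast,
          ← ENNReal.ofReal_mul n.cast_nonneg]
    _ ≤ ENNReal.ofReal (1 / (n : ℝ) ^ 10) := by
        refine ENNReal.ofReal_le_ofReal ?_
        have : (n : ℝ) * (1 / (n : ℝ) ^ 12 + 1 / (n : ℝ) ^ 12) =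
            2 / n * (1 / (n : ℝ) ^ 10) := by
          field_simp
          ring
        rw [this]
        exact mul_le_of_le_one_left (by positivity) ((div_le_one (by linarith)).2 two_le)

end IsConnectedWeighting

/-! ### The estimator on the good event -/

namespace IsConnectedWeighting

variable {n L : ℕ} {G : SimpleGraph (Fin n)} {w p : Fin n → Fin n → ℝ} {θ : Fin n → ℝ}
variable (hw : IsConnectedWeighting G w) (hn : 2 ≤ n)
include hw

theorem sample_size_ratio_le (θ : Fin n → ℝ) :
    condNumber hn θ ^ 4 * wMax w * dMax w ^ 2 * Real.log n ^ 2 / spectralGap hn w ^ 3 ≤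
      4 * (condNumber hn θ ^ 4 * wMax w * dMax w ^ 4 * Real.log n ^ 2 / spectralGap hn w ^ 5) := by
  have gap_pos := hw.gap_pos hn
  have κ_pos := condNumber_pos hn θ
  have wMax_pos := hw.wMax_pos hn
  have dMax_pos := hw.dMax_pos hn
  have one_le : 1 ≤ (2 * dMax w / spectralGap hn w) ^ 2 :=
    one_le_pow₀ ((one_le_div gap_pos).2 (hw.gap_le hn))
  refine (le_mul_of_one_le_right (by positivity) one_le).trans_eq ?_
  field_simp
  ring

theorem newtonStep_bound_le (hL : 0 < L) (θ : Fin n → ℝ) :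
    51 * noiseVariance hn L θ w * Real.log n ≤
      (15 * condNumber hn θ * √(wMax w * Real.log n / (spectralGap hn w * L))) ^ 2 := by
  have gap_pos := hw.gap_pos hn
  have wMax_pos := hw.wMax_pos hn
  have log_pos : 0 < Real.log n := Real.log_pos (Nat.one_lt_cast.2 hn)
  rw [hw.noiseVariance_eq hn, mul_pow, Real.sq_sqrt (by positivity)]
  have : 0 ≤ condNumber hn θ ^ 2 * (wMax w * Real.log n / (spectralGap hn w * L)) := by positivity
  calc 51 * (4 * condNumber hn θ ^ 2 * wMax w / (spectralGap hn w * L)) * Real.log n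
      = 204 * (condNumber hn θ ^ 2 * (wMax w * Real.log n / (spectralGap hn w * L))) := by ring
    _ ≤ _ := by linarith

theorem secondOrderBound_eq (L : ℕ) (θ : Fin n → ℝ) : secondOrderBound hn L θ w =
    1984 * condNumber hn θ ^ 3 * wMax w * dMax w * Real.log n / (spectralGap hn w ^ 2 * L) := by
  rw [secondOrderBound, hw.noiseVariance_eq hn, hw.algebraicConnectivity_eq hn]
  ring

variable (hL : 5000000 * (condNumber hn θ ^ 4 * wMax w * dMax w ^ 2 * Real.log n ^ 2 /
  spectralGap hn w ^ 3) ≤ L)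
include hL

theorem sample_size_pos : 0 < L := by
  have gap_pos := hw.gap_pos hn
  have κ_pos := condNumber_pos hn θ
  have wMax_pos := hw.wMax_pos hn
  have dMax_pos := hw.dMax_pos hn
  have log_pos : 0 < Real.log n := Real.log_pos (Nat.one_lt_cast.2 hn)
  exact Nat.cast_pos.1 (lt_of_lt_of_le (by positivity) hL)

theorem sum_greenFlow_bound_mul_le :
    28 * (condNumber hn θ * dMax w / spectralGap hn w) * Real.log n *
      secondOrderBound hn L θ w ≤ 1 / 50 := by
  have gap_pos := hw.gap_pos hn
  have L_pos : (0 : ℝ) < L := Nat.cast_pos.2 (hw.sample_size_pos hn hL)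
  rw [hw.secondOrderBound_eq hn]
  calc _ = 55552 * (condNumber hn θ ^ 4 * wMax w * dMax w ^ 2 * Real.log n ^ 2 /
        spectralGap hn w ^ 3) / L := by
        field_simp
        ring
    _ ≤ 1 / 50 := by
        rw [div_le_iff₀ L_pos]
        linarith

theorem secondOrderBound_le : secondOrderBound hn L θ w ≤
    2 * condNumber hn θ * √(wMax w * Real.log n / (spectralGap hn w * L)) := by
  have gap_pos := hw.gap_pos hn
  have κ_pos := condNumber_pos hn θ
  have wMax_pos := hw.wMax_pos hn
  have L_pos : (0 : ℝ) < L := Nat.cast_pos.2 (hw.sample_size_pos hn hL)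
  have le_log := two_div_three_le_log hn
  have : 0 < Real.log n := by linarith
  refine le_of_abs_le (abs_le_of_sq_le_sq ?_ (by positivity))
  rw [hw.secondOrderBound_eq hn, mul_pow _ √_, Real.sq_sqrt (by positivity)]
  have ratio_le : 1984 ^ 2 * (condNumber hn θ ^ 4 * wMax w * dMax w ^ 2 * Real.log n ^ 2 /
      spectralGap hn w ^ 3) / (L * Real.log n) ≤ 4 := by
    rw [div_le_iff₀ (by positivity)]
    nlinarith
  calc _ = condNumber hn θ ^ 2 * (wMax w * Real.log n / (spectralGap hn w * L)) *
        (1984 ^ 2 * (condNumber hn θ ^ 4 * wMax w * dMax w ^ 2 * Real.log n ^ 2 /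
          spectralGap hn w ^ 3) / (L * Real.log n)) := by field_simp
    _ ≤ condNumber hn θ ^ 2 * (wMax w * Real.log n / (spectralGap hn w * L)) * 4 :=
        mul_le_mul_of_nonneg_left ratio_le (by positivity)
    _ = _ := by ring

theorem exists_isCritical_of_mem_goodSet (hθ : Antitone θ) (hp : ∀ i j, p i j + p j i = 1)
    (hgood : (w, p) ∈ goodSet hn L θ) :
    ∃ θ', ∑ i, θ' i = ∑ i, θ i ∧ IsCritical w p θ' ∧ ‖θ' - θ‖ ≤
      17 * condNumber hn θ * √(wMax w * Real.log n / (spectralGap hn w * L)) := by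
  have : NeZero n := ⟨by omega⟩
  have κ_pos := condNumber_pos hn θ
  have L_pos := hw.sample_size_pos hn hL
  have bound_nonneg : 0 ≤ secondOrderBound hn L θ w :=
    (Finset.sum_nonneg fun i _ => mul_nonneg (greenFlow_nonneg hw.nonneg _ 0 i) (sq_nonneg _)).trans
      (hgood 0).2
  obtain ⟨θ', sum_eq, critical, abs_sub_le⟩ := exists_isCritical hw.symm (hw.hess_gap_pos hn θ)
    (hw.hess_hasGap hn hθ) hw.nonneg
    (S := 28 * (condNumber hn θ * dMax w / spectralGap hn w) * Real.log n)
    (fun k => (hw.sum_greenFlow_le hn hθ k).trans_eq (by ring)) (fun k => (hgood k).2)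
    bound_nonneg (hw.sum_greenFlow_bound_mul_le hn hL) hp
  refine ⟨θ', sum_eq, critical, (pi_norm_le_iff_of_nonneg (by positivity)).2 fun k => ?_⟩
  have step_le := abs_le_of_sq_le_sq ((hgood k).1.trans (hw.newtonStep_bound_le hn L_pos θ))
    (by positivity)
  calc |θ' k - θ k| ≤ |newtonStep w p θ k| + secondOrderBound hn L θ w := abs_sub_le k
    _ ≤ 15 * condNumber hn θ * √(wMax w * Real.log n / (spectralGap hn w * L)) +
        2 * condNumber hn θ * √(wMax w * Real.log n / (spectralGap hn w * L)) :=
        add_le_add step_le (hw.secondOrderBound_le hn hL)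
    _ = _ := by ring

theorem exists_forall_isWeightedMLE_iff [DecidableRel G.Adj] (hθ : Antitone θ)
    (hsum : ∑ i, θ i = 0) {Ω : Type*} {y : Fin n → Fin n → Fin L → Ω → Bool} {ω : Ω}
    (hgood : (w, observedFreq G (observed G y ω)) ∈ goodSet hn L θ) :
    ∃ θ', (∀ θ'', IsWeightedMLE w (fun i j l => y i j l ω) θ'' ↔ θ'' = θ') ∧ ‖θ' - θ‖ ≤
      17 * condNumber hn θ * √(wMax w * Real.log n / (spectralGap hn w * L)) := by
  obtain ⟨θ', sum_eq, critical, norm_sub_le⟩ :=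
    hw.exists_isCritical_of_mem_goodSet hn hL hθ (winFreq_add_swap _) hgood
  exact ⟨θ', isWeightedMLE_iff_eq (hw.sample_size_pos hn hL) hw.symm hw.nonneg hw.diag
    (hw.gap_pos hn) (hw.hasGap hn) ((isCritical_observedFreq_iff hw.supported ω).1 critical)
    (sum_eq.trans hsum), norm_sub_le⟩

end IsConnectedWeighting

/-! ### Recovery of the largest entries -/

section Recovery

variable {n : ℕ} {θ θ' : Fin n → ℝ} {K : ℕ}

theorem recoversTop_of_forall_lt (hK : K ≤ n)
    (hlt : ∀ i j : Fin n, (i : ℕ) < K → K ≤ (j : ℕ) → θ j < θ i) : RecoversTop θ K := by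
  have card_top : (Finset.univ.filter fun i : Fin n => (i : ℕ) < K).card = K := by
    rw [Fin.card_filter_val_lt, min_eq_right hK]
  refine fun S => ⟨fun ⟨card_eq, le_of_mem⟩ => ?_, ?_⟩
  · by_contra hne
    obtain ⟨i, hi, hi_top⟩ := Finset.not_subset.1 fun h =>
      hne (Finset.eq_of_subset_of_card_le h (card_top.trans card_eq.symm).le)
    obtain ⟨j, hj, hjS⟩ := Finset.not_subset.1 fun h =>
      hne (Finset.eq_of_subset_of_card_le h (card_eq.trans card_top.symm).le).symm
    simp only [Finset.mem_filter, Finset.mem_univ, true_and, not_lt] at hj hi_top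
    exact (hlt j i hj hi_top).not_ge (le_of_mem i hi j hjS)
  · rintro rfl
    refine ⟨card_top, fun i hi j hj => ?_⟩
    simp only [Finset.mem_filter, Finset.mem_univ, true_and, not_lt] at hi hj
    exact (hlt i j hi hj).le

theorem recoversTop_of_norm_sub_le (hθ : Antitone θ) (hK : K < n) {ε : ℝ}
    (hε : ‖θ' - θ‖ ≤ ε) (hgap : 2 * ε < scoreGap θ K hK) : RecoversTop θ' K := by
  refine recoversTop_of_forall_lt hK.le fun i j hi hj => ?_
  have le_left : θ ⟨K - 1, by omega⟩ ≤ θ i := hθ (Fin.mk_le_mk.2 (by omega))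
  have le_right : θ j ≤ θ ⟨K, hK⟩ := hθ (Fin.mk_le_mk.2 hj)
  have near_left := abs_le.1 ((norm_le_pi_norm (θ' - θ) i).trans hε)
  have near_right := abs_le.1 ((norm_le_pi_norm (θ' - θ) j).trans hε)
  rw [Pi.sub_apply] at near_left near_right
  rw [scoreGap] at hgap
  linarith

theorem IsConnectedWeighting.two_mul_error_lt {G : SimpleGraph (Fin n)} {w : Fin n → Fin n → ℝ}
    (hw : IsConnectedWeighting G w) (hn : 2 ≤ n) {L : ℕ} (hL : 0 < L) {Δ : ℝ} (hΔ : 0 < Δ)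
    (hLΔ : 3000 * (condNumber hn θ ^ 2 * wMax w * Real.log n / (spectralGap hn w * Δ ^ 2)) ≤ L) :
    2 * (17 * condNumber hn θ * √(wMax w * Real.log n / (spectralGap hn w * L))) < Δ := by
  have gap_pos := hw.gap_pos hn
  have wMax_pos := hw.wMax_pos hn
  have log_pos : 0 < Real.log n := Real.log_pos (Nat.one_lt_cast.2 hn)
  refine lt_of_pow_lt_pow_left₀ 2 hΔ.le ?_
  rw [mul_pow, mul_pow, Real.sq_sqrt (by positivity)]
  have sq_error_le : 3000 * (condNumber hn θ ^ 2 * (wMax w * Real.log n / (spectralGap hn w * L))) ≤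
      Δ ^ 2 := by
    rw [mul_div_assoc', div_le_iff₀ (by positivity)] at hLΔ
    rw [mul_div_assoc', mul_div_assoc', div_le_iff₀ (by positivity)]
    linarith
  nlinarith [sq_pos_of_pos hΔ]

end Recovery

/-! ### Random weights -/

section Events

variable {Ω α β : Type*} [MeasurableSpace Ω] [MeasurableSpace α] [MeasurableSpace β]
  {μ : Measure Ω} [IsProbabilityMeasure μ]

theorem measure_prodMk_mem_le {f : Ω → α} {g : Ω → β} (hf : Measurable f) (hg : Measurable g)
    (hfg : IndepFun f g μ) {s : Set (α × β)} (hs : MeasurableSet s) {c : ENNReal}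
    (hc : ∀ᵐ ω' ∂μ, μ {ω | (f ω', g ω) ∈ s} ≤ c) : μ {ω | (f ω, g ω) ∈ s} ≤ c := by
  have := Measure.isProbabilityMeasure_map (μ := μ) hg.aemeasurable
  calc μ {ω | (f ω, g ω) ∈ s} = μ.map (fun ω => (f ω, g ω)) s :=
        (Measure.map_apply (hf.prodMk hg) hs).symm
    _ = ∫⁻ ω', μ {ω | (f ω', g ω) ∈ s} ∂μ := by
        have := Measure.isProbabilityMeasure_map (μ := μ) hf.aemeasurable
        rw [(indepFun_iff_map_prod_eq_prod_map_map hf.aemeasurable hg.aemeasurable).1 hfg,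
          Measure.prod_apply hs, lintegral_map (measurable_measure_prodMk_left hs) hf]
        exact lintegral_congr fun ω' => Measure.map_apply hg (measurable_prodMk_left hs)
    _ ≤ ∫⁻ _, c ∂μ := lintegral_mono_ae hc
    _ = c := by rw [lintegral_const, measure_univ, mul_one]

theorem exists_measurableSet_forall_of_ae {B : Set Ω} (hB : MeasurableSet B) {P : Ω → Prop}
    (hP : ∀ᵐ ω ∂μ, P ω) {ε : ℝ} (hε : 0 ≤ ε) (hμ : μ Bᶜ ≤ ENNReal.ofReal ε) :
    ∃ A, MeasurableSet A ∧ 1 - ε ≤ μ.real A ∧ ∀ ω ∈ A, ω ∈ B ∧ P ω := by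
  obtain ⟨N, not_subset, measurable_N, null_N⟩ := exists_measurable_superset_of_null (ae_iff.1 hP)
  refine ⟨B \ N, hB.diff measurable_N, ?_, fun ω hω => ⟨hω.1, ?_⟩⟩
  · have := ENNReal.toReal_le_of_le_ofReal hε hμ
    rw [measureReal_def, measure_sdiff_null null_N, ← measureReal_def]
    rw [← measureReal_def, probReal_compl_eq_one_sub hB] at this
    linarith
  · exact not_not.1 fun h => hω.2 (not_subset h)

end Events

end BTL

theorem mainTheorem2_general :
    ∃ C₁ C₂ C₃ : ℝ, 0 < C₁ ∧ 0 < C₂ ∧ 0 < C₃ ∧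
      ∀ (n : ℕ) (hn : 2 ≤ n) (L : ℕ) (θs : Fin n → ℝ), Antitone θs → ∑ i, θs i = 0 →
      ∀ (G : SimpleGraph (Fin n))
        (Ω : Type*) [MeasurableSpace Ω] (μ : Measure Ω) [IsProbabilityMeasure μ]
        (y : Fin n → Fin n → Fin L → Ω → Bool) (w : Ω → Fin n → Fin n → ℝ),
      IsBTLSample μ G θs y →
      Measurable w →
      IndepFun w (observed G y) μ →
      (∀ᵐ ω ∂μ, IsWeighting G (w ω) ∧ (supportGraph (w ω)).Connected ∧
        C₁ * (condNumber hn θs ^ 4 * wMax (w ω) * dMax (w ω) ^ 2 * Real.log n ^ 2 /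
          spectralGap hn (w ω) ^ 3) ≤ (L : ℝ)) →
      ∃ A : Set Ω, MeasurableSet A ∧ 1 - 1 / (n : ℝ) ^ 10 ≤ μ.real A ∧
        ∀ ω ∈ A,
          (∃! θ, IsWeightedMLE (w ω) (fun i j l => y i j l ω) θ) ∧
          ∀ θ, IsWeightedMLE (w ω) (fun i j l => y i j l ω) θ →
            ‖θ - θs‖ ≤ C₂ * condNumber hn θs *
              Real.sqrt (wMax (w ω) * Real.log n / (spectralGap hn (w ω) * L)) ∧
            ∀ (K : ℕ) (hK : K < n), 1 ≤ K → 0 < scoreGap θs K hK →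
              C₃ * (condNumber hn θs ^ 2 * wMax (w ω) * Real.log n /
                (spectralGap hn (w ω) * scoreGap θs K hK ^ 2)) ≤ (L : ℝ) →
              RecoversTop θ K := by
  classical
  refine ⟨5000000, 17, 3000, by norm_num, by norm_num, by norm_num, ?_⟩
  intro n hn L θs hθ hsum G Ω _ μ _ y w hy measurable_w indep h_ae
  replace h_ae := h_ae.mono fun ω h =>
    (⟨⟨h.1, h.2.1⟩, h.2.2⟩ : BTL.IsConnectedWeighting G (w ω) ∧ _)
  have measurable_freq := (BTL.measurable_observedFreq G).comp (BTL.measurable_observed hy)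
  have measure_bad_le := BTL.measure_prodMk_mem_le measurable_w measurable_freq
    (indep.comp measurable_id (BTL.measurable_observedFreq G))
    (BTL.measurableSet_goodSet hn L θs).compl
    (h_ae.mono fun ω h => h.1.measure_notMem_goodSet_le hn (h.1.sample_size_pos hn h.2) hθ hy)
  obtain ⟨A, measurable_A, le_measure_A, good⟩ := BTL.exists_measurableSet_forall_of_ae
    (measurable_w.prodMk measurable_freq (BTL.measurableSet_goodSet hn L θs)) h_ae (by positivity)
    measure_bad_le
  refine ⟨A, measurable_A, le_measure_A, fun ω hω => ?_⟩
  obtain ⟨hgood, hw, hL⟩ := good ω hω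
  obtain ⟨θ, isWeightedMLE_iff, norm_sub_le⟩ :=
    hw.exists_forall_isWeightedMLE_iff hn hL hθ hsum hgood
  refine ⟨⟨θ, (isWeightedMLE_iff θ).2 rfl, fun θ' => (isWeightedMLE_iff θ').1⟩, fun θ' hθ' => ?_⟩
  rw [(isWeightedMLE_iff θ').1 hθ']
  exact ⟨norm_sub_le, fun K hK _ hΔ hLK => BTL.recoversTop_of_norm_sub_le hθ hK norm_sub_le
    (hw.two_mul_error_lt hn (hw.sample_size_pos hn hL) hΔ hLK)⟩

theorem mainTheorem2 :
    ∃ C₁ C₂ C₃ : ℝ, 0 < C₁ ∧ 0 < C₂ ∧ 0 < C₃ ∧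
      ∀ (n : ℕ) (hn : 2 ≤ n) (L : ℕ) (θs : Fin n → ℝ), Antitone θs → ∑ i, θs i = 0 →
      ∀ (G : SimpleGraph (Fin n))
        (Ω : Type*) [MeasurableSpace Ω] (μ : Measure Ω) [IsProbabilityMeasure μ]
        (y : Fin n → Fin n → Fin L → Ω → Bool) (w : Ω → Fin n → Fin n → ℝ),
      IsBTLSample μ G θs y →
      Measurable w →
      IndepFun w (observed G y) μ →
      (∀ᵐ ω ∂μ, IsWeighting G (w ω) ∧ (supportGraph (w ω)).Connected ∧
        wMax (w ω) ≤ (n : ℝ) ^ 2 ∧ 1 ≤ dMin (w ω) ∧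
        C₁ * (condNumber hn θs ^ 4 * wMax (w ω) * dMax (w ω) ^ 4 * Real.log n ^ 2 /
          spectralGap hn (w ω) ^ 5) ≤ (L : ℝ)) →
      ∃ A : Set Ω, MeasurableSet A ∧ 1 - 1 / (n : ℝ) ^ 10 ≤ μ.real A ∧
        ∀ ω ∈ A,
          (∃! θ, IsWeightedMLE (w ω) (fun i j l => y i j l ω) θ) ∧
          ∀ θ, IsWeightedMLE (w ω) (fun i j l => y i j l ω) θ →
            ‖θ - θs‖ ≤ C₂ * condNumber hn θs *
              Real.sqrt (wMax (w ω) * Real.log n / (spectralGap hn (w ω) * L)) ∧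
            ∀ (K : ℕ) (hK : K < n), 1 ≤ K → 0 < scoreGap θs K hK →
              C₃ * (condNumber hn θs ^ 2 * wMax (w ω) * Real.log n /
                (spectralGap hn (w ω) * scoreGap θs K hK ^ 2)) ≤ (L : ℝ) →
              RecoversTop θ K := by
  obtain ⟨C₁, C₂, C₃, hC₁, hC₂, hC₃, main⟩ := mainTheorem2_general
  refine ⟨C₁ * 4, C₂, C₃, by positivity, hC₂, hC₃, ?_⟩
  intro n hn L θs hθ hsum G Ω _ μ _ y w hy hw indep h_ae
  exact main n hn L θs hθ hsum G Ω μ y w hy hw indep <|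
    h_ae.mono fun ω ⟨weighting, connected, _, _, hL⟩ => ⟨weighting, connected,
      (mul_le_mul_of_nonneg_left ((BTL.IsConnectedWeighting.mk weighting
        connected).sample_size_ratio_le hn θs) hC₁.le).trans
        ((mul_assoc C₁ 4 _).symm.trans_le hL)⟩
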